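/- Let $q>2$ be a power of $2$, let $a\in\mathrm{GF}(q^2)$ with $a\neq0$, and let $b\in\mathrm{GF}(q^2)\setminus\mathrm{GF}(q)$. Put $\mathrm{Tr}(x)=x+x^q$ for $x\in \mathrm{GF}(q^2)$. Let $(J,X,Y,Z)$ be homogeneous coordinates in $\mathrm{PG}(3,q^2)$, let $\mathcal B_{a,b}$ be the surface $$Z^qJ^q-ZJ^{2q-1}+a^q(X^{2q}+Y^{2q})-a(X^2+Y^2)J^{2q-2}=(b^q-b)(X^{q+1}+Y^{q+1})J^{q-1},$$ let $\mathcal B_\infty=\mathcal B_{a,b}\cap\{J=0\}$, let $\mathcal F=\{(0,X,Y,Z): X^{q+1}+Y^{q+1}=0\}$, and let $\mathcal M_{a,b}=(\mathcal B_{a,b}\setminus\mathcal B_\infty)\cup\mathcal F$. Define $\mathcal M_{1,\epsilon}$ in the same way for $\epsilon\in\mathrm{GF}(q^2)\setminus\mathrm{GF}(q)$. A non-singular matrix $M$ together with a field automorphism $\theta$ represents the collineation $\langle v\rangle\mapsto\langle v^\theta M\rangle$, where $v$ is a row vector. Let $G(a,b)$ and $\Gamma(a,b)$ be the stabilizers of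 $\mathcal M_{a,b}$ in $\mathrm{PGL}_4(q^2)$ and in $\mathrm{P\Gamma L}_4(q^2)$. For $\gamma=(\gamma_1,\gamma_2)\in\mathrm{GF}(q^2)^2$ and $s,e,\delta\in\mathrm{GF}(q)$ with $\delta\ne0$, let $\phi_s,\psi_\gamma(a,b),\tau_e,\mu_\delta$ be the projectivities with matrices $$\begin{pmatrix}1&0&0&s\\0&1&0&0\\0&0&1&0\\0&0&0&1\end{pmatrix},\quad \begin{pmatrix}1&\gamma_1&\gamma_2&a(\gamma_1^2+\gamma_2^2)+b(\gamma_1^{q+1}+\gamma_2^{q+1})\\0&1&0&(b+b^q)\gamma_1^q+2a\gamma_1\\0&0&1&(b+b^q)\gamma_2^q+2a\gamma_2\\0&0&0&1\end{pmatrix},\quad \begin{pmatrix}1&0&0&0\\0&e+1&e&0\\0&e&e+1&0\\0&0&0&1\end{pmatrix},\quad \mathrm{diag}(1,\delta,\delta,\delta^2).$$ Say that a collineation has normal form if it is represented by some field automorphism together with a non-singular matrix $$\begin{pmatrix}1&0&0&0\\0&d&e&0\\0&\lambda_1e&\lambda_2d&0\\0&0&0&c\end{pmatrix},\qquad c\in\mathrm{GF}(q)^*,\quad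 d,e,\lambda_1,\lambda_2\in\mathrm{GF}(q^2),\quad \lambda_1^{q+1}=\lambda_2^{q+1}=1,$$ for which one of the following holds: (I) $e=0$, $d\ne0$, $\lambda_2=1$; (II) $e\neq0$, $d=0$, $\lambda_1=1$; (III) $e\ne0\ne d$, $\lambda_1=\lambda_2=1$, $d/e\in\mathrm{GF}(q)\setminus\{1\}$; (IV) $e\ne0\neq d$, $\lambda_2\ne1\neq\lambda_1$, $\lambda_1\ne\lambda_2$, $d=\frac{1+\lambda_1}{1+\lambda_2}e$. Then $|\Gamma(a,b)|=2\,q^6(q-1)\log_2q$. Moreover, for every $\epsilon\in\mathrm{GF}(q^2)$ with $\mathrm{Tr}(\epsilon)=1$ there is a collineation $\beta$ of normal form that maps $\mathcal M_{1,\epsilon}$ onto $\mathcal M_{a,b}$. For every such $\beta$ and every collineation $\sigma:\langle v\rangle\mapsto\langle v^\theta\rangle$ induced by a generator $\theta$ of $\mathrm{Aut}(\mathrm{GF}(q^2))$, write $\sigma^\beta$ for the collineation that applies first $\beta^{-1}$, then $\sigma$, then $\beta$; then $$\Gamma(a,b)=\langle\phi_s,\psi_\gamma(a,b),\tau_e,\mu_\delta,\sigma^\beta:\gamma\in\mathrm{GF}(q^2)^2,\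 s,e,\delta\in\mathrm{GF}(q),\ \delta\neq0\rangle=\langle G(a,b),\sigma^\beta\rangle .$$ -/

import Mathlib

open scoped LinearAlgebra.Projectivization Matrix Pointwise

/-- The points of `PG(3,F)`; homogeneous coordinates `(J, X, Y, Z)` are indexed by `0, 1, 2, 3`. -/
abbrev PG3 (F : Type*) [Field F] : Type _ := ℙ F (Fin 4 → F)

/-- The bijective semilinear map `v ↦ v^θ M`: first apply the field automorphism `θ` to each entry
of the row vector `v`, then multiply on the right by the matrix `M`. -/
def semilinearMap {F : Type*} [Field F] (M : GL (Fin 4) F) (θ : F ≃+* F) :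
    (Fin 4 → F) →ₛₗ[(θ : F →+* F)] (Fin 4 → F) where
  toFun v := (fun i => θ (v i)) ᵥ* (M : Matrix (Fin 4) (Fin 4) F)
  map_add' v w := by
    rw [← Matrix.add_vecMul]
    congr 1
    funext i
    simp
  map_smul' c v := by
    rw [← Matrix.smul_vecMul]
    congr 1
    funext i
    simp

theorem semilinearMap_injective {F : Type*} [Field F] (M : GL (Fin 4) F) (θ : F ≃+* F) :
    Function.Injective (semilinearMap M θ) := by
  intro v w h
  have h1 : (fun i => θ (v i)) = fun i => θ (w i) :=
    Matrix.vecMul_injective_of_isUnit (A := (M : Matrix (Fin 4) (Fin 4) F)) M.isUnit h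
  funext i
  exact θ.injective (congrFun h1 i)

/-- The map induced on points by `v ↦ v^θ M`. -/
def collineationFun {F : Type*} [Field F] (M : GL (Fin 4) F) (θ : F ≃+* F) : PG3 F → PG3 F :=
  Projectivization.map (semilinearMap M θ) (semilinearMap_injective M θ)

theorem collineationFun_comp {F : Type*} [Field F] (M N : GL (Fin 4) F) (θ η : F ≃+* F)
    (P : PG3 F) :
    collineationFun N η (collineationFun M θ P) =
      collineationFun (Matrix.GeneralLinearGroup.map (η : F →+* F) M * N) (θ.trans η) P := by
  induction P using Projectivization.ind with
  | h v hv =>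
    simp only [collineationFun, Projectivization.map_mk]
    congr 1
    change (fun i => η (((fun i => θ (v i)) ᵥ* (M : Matrix (Fin 4) (Fin 4) F)) i)) ᵥ*
      (N : Matrix (Fin 4) (Fin 4) F) = (fun i => η (θ (v i))) ᵥ*
      ((Matrix.GeneralLinearGroup.map (η : F →+* F) M * N : GL (Fin 4) F) :
        Matrix (Fin 4) (Fin 4) F)
    rw [Units.val_mul, ← Matrix.vecMul_vecMul]
    congr 1
    funext i
    simp [Matrix.vecMul, dotProduct]

theorem collineationFun_one {F : Type*} [Field F] (P : PG3 F) :
    collineationFun (1 : GL (Fin 4) F) (RingEquiv.refl F) P = P := by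
  induction P using Projectivization.ind with
  | h v hv =>
    simp only [collineationFun, Projectivization.map_mk]
    congr 1
    change (fun i => v i) ᵥ* ((1 : GL (Fin 4) F) : Matrix (Fin 4) (Fin 4) F) = v
    rw [Units.val_one, Matrix.vecMul_one]

/-- The collineation of `PG(3,F)` represented by the non-singular matrix `M` and the field
automorphism `θ`, that is, `⟨v⟩ ↦ ⟨v^θ M⟩`. -/
def collineation {F : Type*} [Field F] (M : GL (Fin 4) F) (θ : F ≃+* F) :
    Equiv.Perm (PG3 F) where
  toFun := collineationFun M θ
  invFun := collineationFun (Matrix.GeneralLinearGroup.map (θ.symm : F →+* F) M⁻¹) θ.symm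
  left_inv P := by
    rw [collineationFun_comp, ← map_mul, mul_inv_cancel, map_one, RingEquiv.self_trans_symm,
      collineationFun_one]
  right_inv P := by
    rw [collineationFun_comp]
    have h : Matrix.GeneralLinearGroup.map (θ : F →+* F)
        (Matrix.GeneralLinearGroup.map (θ.symm : F →+* F) M⁻¹) = M⁻¹ := by
      refine Units.ext (Matrix.ext fun i j => ?_)
      exact θ.apply_symm_apply _
    rw [h, inv_mul_cancel, RingEquiv.symm_trans_self, collineationFun_one]

theorem collineation_mul {F : Type*} [Field F] (M N : GL (Fin 4) F) (θ η : F ≃+* F) :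
    collineation N η * collineation M θ =
      collineation (Matrix.GeneralLinearGroup.map (η : F →+* F) M * N) (θ.trans η) :=
  Equiv.ext fun P => collineationFun_comp M N θ η P

theorem collineation_one {F : Type*} [Field F] :
    collineation (1 : GL (Fin 4) F) (RingEquiv.refl F) = 1 :=
  Equiv.ext fun P => collineationFun_one P

theorem collineation_inv {F : Type*} [Field F] (M : GL (Fin 4) F) (θ : F ≃+* F) :
    (collineation M θ)⁻¹ =
      collineation (Matrix.GeneralLinearGroup.map (θ.symm : F →+* F) M⁻¹) θ.symm :=
  Equiv.ext fun _ => rfl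

/-- `PΓL₄(F)`, as a group of permutations of the points of `PG(3,F)` (on which it is faithful). -/
def PGammaL4 (F : Type*) [Field F] : Subgroup (Equiv.Perm (PG3 F)) where
  carrier := {g | ∃ (M : GL (Fin 4) F) (θ : F ≃+* F), g = collineation M θ}
  mul_mem' := by
    rintro _ _ ⟨N, η, rfl⟩ ⟨M, θ, rfl⟩
    exact ⟨_, _, collineation_mul M N θ η⟩
  one_mem' := ⟨1, RingEquiv.refl F, collineation_one.symm⟩
  inv_mem' := by
    rintro _ ⟨M, θ, rfl⟩
    exact ⟨_, _, collineation_inv M θ⟩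

/-- `PGL₄(F)`, as a group of permutations of the points of `PG(3,F)`. -/
def PGL4 (F : Type*) [Field F] : Subgroup (Equiv.Perm (PG3 F)) where
  carrier := {g | ∃ M : GL (Fin 4) F, g = collineation M (RingEquiv.refl F)}
  mul_mem' := by
    rintro _ _ ⟨N, rfl⟩ ⟨M, rfl⟩
    exact ⟨_, collineation_mul M N _ _⟩
  one_mem' := ⟨1, collineation_one.symm⟩
  inv_mem' := by
    rintro _ ⟨M, rfl⟩
    exact ⟨_, collineation_inv M _⟩

/-- The surface `B_{a,b}`, by its projective equation (homogeneous of degree `2q` over the field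
with `q²` elements, so that the choice of the representative `v` does not matter). -/
def surfaceB {F : Type*} [Field F] (q : ℕ) (a b : F) : Set (PG3 F) :=
  {P | ∃ (v : Fin 4 → F) (hv : v ≠ 0), P = Projectivization.mk F v hv ∧
    v 3 ^ q * v 0 ^ q - v 3 * v 0 ^ (2 * q - 1) + a ^ q * (v 1 ^ (2 * q) + v 2 ^ (2 * q))
        - a * (v 1 ^ 2 + v 2 ^ 2) * v 0 ^ (2 * q - 2)
      = (b ^ q - b) * (v 1 ^ (q + 1) + v 2 ^ (q + 1)) * v 0 ^ (q - 1)}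

/-- The hyperplane at infinity `J = 0`. -/
def planeAtInfinity (F : Type*) [Field F] : Set (PG3 F) :=
  {P | ∃ (v : Fin 4 → F) (hv : v ≠ 0), P = Projectivization.mk F v hv ∧ v 0 = 0}

/-- The Hermitian cone `{(0, X, Y, Z) | X^(q+1) + Y^(q+1) = 0}`. -/
def coneAtInfinity (F : Type*) [Field F] (q : ℕ) : Set (PG3 F) :=
  {P | ∃ (v : Fin 4 → F) (hv : v ≠ 0), P = Projectivization.mk F v hv ∧
    v 0 = 0 ∧ v 1 ^ (q + 1) + v 2 ^ (q + 1) = 0}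

/-- The BM quasi-Hermitian variety `M_{a,b} = (B_{a,b} \ B_∞) ∪ 𝓕`, where
`B_∞ = B_{a,b} ∩ {J = 0}` and `𝓕` is the Hermitian cone at infinity. -/
def varietyM {F : Type*} [Field F] (q : ℕ) (a b : F) : Set (PG3 F) :=
  (surfaceB q a b \ (surfaceB q a b ∩ planeAtInfinity F)) ∪ coneAtInfinity F q

/-- `Γ(a,b)`: the stabilizer of `M_{a,b}` in `PΓL₄`. -/
def GammaStab {F : Type*} [Field F] (q : ℕ) (a b : F) : Subgroup (Equiv.Perm (PG3 F)) :=
  PGammaL4 F ⊓ MulAction.stabilizer (Equiv.Perm (PG3 F)) (varietyM q a b)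

/-- `G(a,b)`: the stabilizer of `M_{a,b}` in `PGL₄`. -/
def GStab {F : Type*} [Field F] (q : ℕ) (a b : F) : Subgroup (Equiv.Perm (PG3 F)) :=
  PGL4 F ⊓ MulAction.stabilizer (Equiv.Perm (PG3 F)) (varietyM q a b)

def phiMat {F : Type*} [Field F] (s : F) : Matrix (Fin 4) (Fin 4) F :=
  !![1, 0, 0, s;
     0, 1, 0, 0;
     0, 0, 1, 0;
     0, 0, 0, 1]

def psiMat {F : Type*} [Field F] (q : ℕ) (a b γ₁ γ₂ : F) : Matrix (Fin 4) (Fin 4) F :=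
  !![1, γ₁, γ₂, a * (γ₁ ^ 2 + γ₂ ^ 2) + b * (γ₁ ^ (q + 1) + γ₂ ^ (q + 1));
     0, 1, 0, (b + b ^ q) * γ₁ ^ q + 2 * a * γ₁;
     0, 0, 1, (b + b ^ q) * γ₂ ^ q + 2 * a * γ₂;
     0, 0, 0, 1]

def tauMat {F : Type*} [Field F] (e : F) : Matrix (Fin 4) (Fin 4) F :=
  !![1, 0, 0, 0;
     0, e + 1, e, 0;
     0, e, e + 1, 0;
     0, 0, 0, 1]

def muMat {F : Type*} [Field F] (δ : F) : Matrix (Fin 4) (Fin 4) F :=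
  !![1, 0, 0, 0;
     0, δ, 0, 0;
     0, 0, δ, 0;
     0, 0, 0, δ ^ 2]

/-- The set of all projectivities `φ_s`, `ψ_γ(a,b)`, `τ_e`, `μ_δ` with `γ = (γ₁, γ₂) ∈ F²` and
`s, e, δ ∈ GF(q)`, `δ ≠ 0`; here `GF(q)` is the set of solutions of `x^q = x` in `F`. -/
def linearGenerators {F : Type*} [Field F] (q : ℕ) (a b : F) : Set (Equiv.Perm (PG3 F)) :=
  {g | ∃ A : GL (Fin 4) F, g = collineation A (RingEquiv.refl F) ∧
    ((∃ s : F, s ^ q = s ∧ (A : Matrix (Fin 4) (Fin 4) F) = phiMat s) ∨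
      (∃ γ₁ γ₂ : F, (A : Matrix (Fin 4) (Fin 4) F) = psiMat q a b γ₁ γ₂) ∨
      (∃ e : F, e ^ q = e ∧ (A : Matrix (Fin 4) (Fin 4) F) = tauMat e) ∨
      (∃ δ : F, δ ^ q = δ ∧ δ ≠ 0 ∧ (A : Matrix (Fin 4) (Fin 4) F) = muMat δ))}

/-- The collineation `g` has *normal form*: it is represented by some field automorphism and a
non-singular matrix with rows `(1,0,0,0)`, `(0,d,e,0)`, `(0,λ₁e,λ₂d,0)`, `(0,0,0,c)`, where
`c ∈ GF(q)^*`, `λ₁` and `λ₂` have norm `1`, and one of the four listed conditions holds. -/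
def HasNormalForm {F : Type*} [Field F] (q : ℕ) (g : Equiv.Perm (PG3 F)) : Prop :=
  ∃ (A : GL (Fin 4) F) (θ : F ≃+* F) (c d e l₁ l₂ : F),
    g = collineation A θ ∧
    (A : Matrix (Fin 4) (Fin 4) F) =
      !![1, 0, 0, 0;
         0, d, e, 0;
         0, l₁ * e, l₂ * d, 0;
         0, 0, 0, c] ∧
    c ^ q = c ∧ c ≠ 0 ∧ l₁ ^ (q + 1) = 1 ∧ l₂ ^ (q + 1) = 1 ∧
    ((e = 0 ∧ d ≠ 0 ∧ l₂ = 1) ∨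
      (e ≠ 0 ∧ d = 0 ∧ l₁ = 1) ∨
      (e ≠ 0 ∧ d ≠ 0 ∧ l₁ = 1 ∧ l₂ = 1 ∧ (d / e) ^ q = d / e ∧ d / e ≠ 1) ∨
      (e ≠ 0 ∧ d ≠ 0 ∧ l₂ ≠ 1 ∧ l₁ ≠ 1 ∧ l₁ ≠ l₂ ∧ d = (1 + l₁) / (1 + l₂) * e))

/-!
Write `x̄ = x^q`, `Tr x = x + x̄`, `N x = x x̄`, `T = Tr b`, and recall that `q` is a power of `2`.
The points of `M_{a,b}` are the zeros of the function
`Q(v) = Tr(Z J̄ + a (X + Y)² J^(q-1)) + T (N X + N Y)`, a Hermitian form perturbed by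
`Tr(a (X + Y)² J^(q-1))`. It satisfies `Q(k v) = N(k) Q(v)`.

The main point is that a projectivity `g` preserving `Q = 0` fixes the plane `J = 0`. The points of
the line `J = X + Y = 0` (the axis) are exactly those that lie on two lines of the variety
(`exists_common_line`, `exists_span_of_onAxis`), so `g` fixes the axis. Along vectors `w` of the
axis, `Q(v + w) = Q(v) + Tr B(v, w)`, where `B` is the Hermitian form and `B(v, ·)` is linear;
comparing zeros gives `Q(g v) = r Q(v)` with a constant `r ∈ GF(q)^*` (`exists_multiplier`). Hence
the perturbation is changed only by a factor and a Hermitian form. If `g` moved the plane `J = 0`,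
the monomial `w^(q-1)` would appear, and it is independent of `1, w, w^q, w^(q+1), w², w^(2q)` for
`q > 2` (`map_apply_zero`).

Since the translations `ψ_γ φ_s` are transitive on the affine points, `g` may be assumed to fix
`(1, 0, 0, 0)`. It is then a similitude of `B` that preserves `X + Y` up to a factor, which forces
`g = τ_e μ_δ` (`eq_mu_tau`). So `G(a,b)` is generated by the linear generators, and its elements
are uniquely `φ_s ψ_γ τ_e μ_δ`.

The variety `M_{1,ε}` with `Tr ε = 1` has an equation over `GF(2)`, so it is fixed by every field
automorphism; conjugating by `β : M_{1,ε} → M_{a,b}` shows that every automorphism is the companion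
of an element of `Γ(a,b)`. Both remaining claims follow, because the kernel of the companion map is
`G(a,b)`. A `β` of type (I) or (IV) is constructed in `exists_normalForm`.
-/

namespace QuasiHermitian

section Form

variable {F : Type*} [Field F]

/-! ### The form of the variety -/

/-- The trace `x + x̄` with respect to an involution `c : x ↦ x̄` of the field. -/
def tr (c : F →+* F) (x : F) : F := x + c x

theorem tr_add (c : F →+* F) (x y : F) : tr c (x + y) = tr c x + tr c y := by
  simp only [tr, map_add]; ring

theorem tr_mul_of_fixed {c : F →+* F} {k : F} (hk : c k = k) (x : F) :
    tr c (k * x) = k * tr c x := by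
  simp only [tr, map_mul, hk]; ring

/-- The Hermitian form of `Tr(Z J̄) + T (X X̄ + Y Ȳ)`, semilinear in the first argument. -/
def hermForm (c : F →+* F) (T : F) (v w : Fin 4 → F) : F :=
  c (v 0) * w 3 + c (v 3) * w 0 + T * (c (v 1) * w 1 + c (v 2) * w 2)

/-- The function `Tr(a u² j^(q-1))`. The power `j^(q-1)` is written `j̄ / j`, which is `0` at
`j = 0` by the convention for division by zero, as it should be. -/
def perturb (c : F →+* F) (a j u : F) : F := tr c (a * u ^ 2 * (c j / j))

/-- The function `Tr(Z J̄ + a (X + Y)² J^(q-1)) + T (X X̄ + Y Ȳ)`, whose zeros are the points of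
`M_{a,b}` when `T = Tr b`. -/
def quasiForm (c : F →+* F) (a T : F) (v : Fin 4 → F) : F :=
  hermForm c T v v + perturb c a (v 0) (v 1 + v 2)

/-- The vector `v` represents a point of the axis `J = X + Y = 0` (in characteristic `2`). -/
def OnAxis (v : Fin 4 → F) : Prop := v 0 = 0 ∧ v 1 = v 2

theorem hermForm_add_left (c : F →+* F) (T : F) (u v w : Fin 4 → F) :
    hermForm c T (u + v) w = hermForm c T u w + hermForm c T v w := by
  simp only [hermForm, Pi.add_apply, map_add]; ring

theorem hermForm_add_right (c : F →+* F) (T : F) (u v w : Fin 4 → F) :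
    hermForm c T u (v + w) = hermForm c T u v + hermForm c T u w := by
  simp only [hermForm, Pi.add_apply]; ring

theorem hermForm_smul_left (c : F →+* F) (T k : F) (v w : Fin 4 → F) :
    hermForm c T (k • v) w = c k * hermForm c T v w := by
  simp only [hermForm, Pi.smul_apply, smul_eq_mul, map_mul]; ring

theorem hermForm_smul_right (c : F →+* F) (T k : F) (v w : Fin 4 → F) :
    hermForm c T v (k • w) = k * hermForm c T v w := by
  simp only [hermForm, Pi.smul_apply, smul_eq_mul]; ring

theorem hermForm_conj {c : F →+* F} (hc : ∀ x, c (c x) = x) {T : F} (hT : c T = T)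
    (v w : Fin 4 → F) : c (hermForm c T v w) = hermForm c T w v := by
  simp only [hermForm, map_add, map_mul, hc, hT]; ring

theorem hermForm_add_smul_self {c : F →+* F} (hc : ∀ x, c (c x) = x) {T : F} (hT : c T = T)
    (v w : Fin 4 → F) (t : F) :
    hermForm c T (v + t • w) (v + t • w) =
      hermForm c T v v + tr c (t * hermForm c T v w) + t * c t * hermForm c T w w := by
  rw [tr, map_mul, hermForm_conj hc hT, hermForm_add_left, hermForm_add_right, hermForm_add_right,
    hermForm_smul_left, hermForm_smul_left, hermForm_smul_right, hermForm_smul_right]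
  ring

theorem perturb_smul {c : F →+* F} (hc : ∀ x, c (c x) = x) (a k j u : F) :
    perturb c a (k * j) (k * u) = k * c k * perturb c a j u := by
  rcases eq_or_ne k 0 with rfl | hk
  · simp [perturb, tr]
  rcases eq_or_ne j 0 with rfl | hj
  · simp [perturb, tr]
  have hk' : c k ≠ 0 := (map_ne_zero c).2 hk
  have hj' : c j ≠ 0 := (map_ne_zero c).2 hj
  simp only [perturb, tr, map_mul, map_div₀, map_pow, hc]
  field_simp

theorem quasiForm_smul {c : F →+* F} (hc : ∀ x, c (c x) = x) (a T k : F) (v : Fin 4 → F) :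
    quasiForm c a T (k • v) = k * c k * quasiForm c a T v := by
  have h := perturb_smul hc a k (v 0) (v 1 + v 2)
  simp only [quasiForm, hermForm_smul_left, hermForm_smul_right, Pi.smul_apply, smul_eq_mul]
  rw [← mul_add, h]; ring

theorem quasiForm_zero (c : F →+* F) (a T : F) : quasiForm c a T 0 = 0 := by
  simp [quasiForm, hermForm, perturb, tr]

theorem hermForm_of_onAxis (c : F →+* F) (T : F) (v : Fin 4 → F) {w : Fin 4 → F} (hw : OnAxis w) :
    hermForm c T v w = c (v 0) * w 3 + T * c (v 1 + v 2) * w 1 := by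
  simp only [hermForm, hw.1, ← hw.2, map_add]; ring

theorem OnAxis.add {v w : Fin 4 → F} (hv : OnAxis v) (hw : OnAxis w) : OnAxis (v + w) := by
  simp [OnAxis, hv.1, hw.1, hv.2, hw.2]

theorem OnAxis.smul {v : Fin 4 → F} (hv : OnAxis v) (k : F) : OnAxis (k • v) := by
  simp [OnAxis, hv.1, hv.2]

theorem conj_tr {c : F →+* F} (hc : ∀ x, c (c x) = x) (x : F) : c (tr c x) = tr c x := by
  simp only [tr, map_add, hc]; ring

theorem conj_quasiForm {c : F →+* F} (hc : ∀ x, c (c x) = x) {T : F} (hT : c T = T)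
    (a : F) (v : Fin 4 → F) : c (quasiForm c a T v) = quasiForm c a T v := by
  rw [quasiForm, map_add, hermForm_conj hc hT, perturb, conj_tr hc]

section CharTwo

variable [CharP F 2]

theorem onAxis_isotropic (c : F →+* F) (T : F) {v w : Fin 4 → F} (hv : OnAxis v) (hw : OnAxis w) :
    hermForm c T v w = 0 := by
  rw [hermForm_of_onAxis c T v hw, hv.1, ← hv.2, CharTwo.add_self_eq_zero]; simp

theorem quasiForm_of_onAxis (c : F →+* F) (a T : F) {v : Fin 4 → F} (hv : OnAxis v) :
    quasiForm c a T v = 0 := by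
  rw [quasiForm, onAxis_isotropic c T hv hv, hv.1]; simp [perturb, tr]

theorem quasiForm_add_of_onAxis {c : F →+* F} (hc : ∀ x, c (c x) = x) {T : F} (hT : c T = T)
    (a : F) (v : Fin 4 → F) {w : Fin 4 → F} (hw : OnAxis w) :
    quasiForm c a T (v + w) = quasiForm c a T v + tr c (hermForm c T v w) := by
  have h := hermForm_add_smul_self hc hT v w 1
  rw [one_smul, one_mul, onAxis_isotropic c T hw hw] at h
  have h1 : (v + w) 1 + (v + w) 2 = v 1 + v 2 := by
    simp only [Pi.add_apply, hw.2]
    linear_combination CharTwo.add_self_eq_zero (w 2)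
  have h0 : (v + w) 0 = v 0 := by simp [hw.1]
  rw [quasiForm, quasiForm, h, h1, h0]; ring

theorem tr_eq_zero_iff (c : F →+* F) (x : F) : tr c x = 0 ↔ c x = x := by
  rw [tr, CharTwo.add_eq_zero, eq_comm]

/-- The trace maps onto `GF(q)`. The element `b` witnesses that the involution is not trivial. -/
theorem tr_surjective_on_fixed {c : F →+* F} (hc : ∀ x, c (c x) = x) {b : F} (hb : c b ≠ b) {k : F}
    (hk : c k = k) : ∃ z, tr c z = k := by
  have h0 : tr c b ≠ 0 := fun h => hb ((tr_eq_zero_iff c b).1 h)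
  have h1 : c (tr c b) = tr c b := by simp only [tr, map_add, hc]; ring
  refine ⟨k / tr c b * b, ?_⟩
  rw [tr_mul_of_fixed (by rw [map_div₀, h1, hk])]
  field_simp

theorem sq_injective {x y : F} (h : x ^ 2 = y ^ 2) : x = y := by
  have h1 : (x + y) ^ 2 = 0 := by rw [CharTwo.add_sq, h, CharTwo.add_self_eq_zero]
  exact CharTwo.add_eq_zero.1 (pow_eq_zero_iff (two_ne_zero) |>.1 h1)

theorem exists_sq_eq [Finite F] (x : F) : ∃ y, y ^ 2 = x :=
  (Finite.injective_iff_surjective.1 fun _ _ => sq_injective) x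

end CharTwo

/-- Independence of the monomials that occur in the form restricted to a line.
The monomials of exponents `0, 1, 2, q - 1, q, q + 1, 2q, q² - q` are distinct and of degree
less than `q²`, so they are linearly independent as functions on the field with `q²` elements. -/
theorem coeff_eq_zero_of_forall [Finite F] {q : ℕ} (hq : 3 < q) (hF : Nat.card F = q ^ 2)
    {k0 k1 k2 k3 k4 k5 k6 k7 : F}
    (h : ∀ w : F, k0 + k1 * w + k2 * w ^ 2 + k3 * w ^ (q - 1) + k4 * w ^ q + k5 * w ^ (q + 1) +
      k6 * w ^ (2 * q) + k7 * w ^ (q * (q - 1)) = 0) :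
    k1 = 0 ∧ k2 = 0 ∧ k3 = 0 := by
  classical
  have := Fintype.ofFinite F
  open Polynomial in
  let P : F[X] := C k0 + C k1 * X + C k2 * X ^ 2 + C k3 * X ^ (q - 1) + C k4 * X ^ q +
    C k5 * X ^ (q + 1) + C k6 * X ^ (2 * q) + C k7 * X ^ (q * (q - 1))
  obtain ⟨n, rfl⟩ : ∃ n, q = n + 4 := ⟨q - 4, by omega⟩
  have hm : (n + 4) * (n + 4 - 1) = n ^ 2 + 7 * n + 12 := by
    rw [show n + 4 - 1 = n + 3 by omega]; ring
  have hn : n ≤ n ^ 2 := Nat.le_self_pow two_ne_zero n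
  have hP : P = 0 := by
    refine Polynomial.eq_zero_of_natDegree_lt_card_of_eval_eq_zero P
      (f := (id : F → F)) Function.injective_id (fun w => ?_) ?_
    · simpa [P] using h w
    · rw [← Nat.card_eq_fintype_card, hF]
      have hsq : (n + 4) ^ 2 = n ^ 2 + 8 * n + 16 := by ring
      refine lt_of_le_of_lt (b := (n + 4) * (n + 4 - 1)) ?_ (by rw [hm]; linarith)
      simp only [P]
      rw [hm]
      compute_degree
      all_goals omega
  have hc : ∀ m, P.coeff m = 0 := fun m => by rw [hP, Polynomial.coeff_zero]
  have e1 := hc 1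
  have e2 := hc 2
  have e3 := hc (n + 3)
  simp only [P, hm, Polynomial.coeff_add, Polynomial.coeff_C_mul, Polynomial.coeff_X_pow,
    Polynomial.coeff_C, Polynomial.coeff_X] at e1 e2 e3
  simp (disch := omega) only [if_neg, if_pos] at e1 e2 e3
  simp only [mul_zero, mul_one, if_true, zero_add, add_zero] at e1 e2 e3
  exact ⟨e1, e2, e3⟩

end Form

section Lines

variable {F : Type*} [Field F]

/-! ### Lines contained in the variety -/

/-- `Tr(αt + βt²)` vanishes identically only if `α = β = 0`; this is where `q > 2` enters. -/
theorem eq_zero_of_tr_eq_zero [Finite F] {q : ℕ} (hq : 3 < q) (hF : Nat.card F = q ^ 2)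
    {c : F →+* F} (hcq : ∀ x, c x = x ^ q) {α β : F} (h : ∀ t, tr c (α * t + β * t ^ 2) = 0) :
    α = 0 ∧ β = 0 := by
  have := coeff_eq_zero_of_forall (k0 := 0) (k1 := α) (k2 := β) (k3 := 0) (k4 := c α) (k5 := 0)
    (k6 := c β) (k7 := 0) hq hF fun w => by
      have h1 := h w
      rw [tr, map_add, map_mul, map_mul, map_pow, hcq w, ← pow_mul] at h1
      rw [mul_comm 2 q]
      linear_combination h1
  exact ⟨this.1, this.2.1⟩

variable [CharP F 2]

theorem eq_zero_of_tr_mul_eq_zero {c : F →+* F} {b : F} (hb : c b ≠ b)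
    {α : F} (h : ∀ t, tr c (t * α) = 0) : α = 0 := by
  by_contra h0
  have := h (b / α)
  rw [div_mul_cancel₀ b h0, tr_eq_zero_iff] at this
  exact hb this

/-- The line joining `v` and `w` lies in the variety. Proportional `v` and `w` are allowed. -/
def SpanInVariety (c : F →+* F) (a T : F) (v w : Fin 4 → F) : Prop :=
  ∀ s t : F, quasiForm c a T (s • v + t • w) = 0

/-- Every line of the variety through an affine point `v = (1, …)` contains the point
`(0, 1, 1, T(X + Y)^q)`. -/
theorem span_of_affine [Finite F] {q : ℕ} (hq : 3 < q) (hF : Nat.card F = q ^ 2)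
    {c : F →+* F} (hcq : ∀ x, c x = x ^ q) (hc : ∀ x, c (c x) = x) {a T : F} (ha : a ≠ 0)
    (hT : c T = T) {v w : Fin 4 → F} (hv : v 0 = 1) (hw0 : w 0 = 0)
    (h : SpanInVariety c a T v w) :
    OnAxis w ∧ w 3 = T * c (v 1 + v 2) * w 1 := by
  have hv0 : quasiForm c a T v = 0 := by simpa using h 1 0
  have hw : hermForm c T w w = 0 := by
    have := h 0 1
    simpa [quasiForm, hw0, perturb, tr] using this
  -- compare coefficients in the form of `v + t w`
  have key : ∀ t, tr c (hermForm c T v w * t + a * (w 1 + w 2) ^ 2 * t ^ 2) = 0 := by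
    intro t
    have h1 := h 1 t
    rw [one_smul, quasiForm, hermForm_add_smul_self hc hT, hw] at h1
    rw [quasiForm] at hv0
    have h2 : perturb c a ((v + t • w) 0) ((v + t • w) 1 + (v + t • w) 2) =
        perturb c a (v 0) (v 1 + v 2) + tr c (a * (w 1 + w 2) ^ 2 * t ^ 2) := by
      have : (v 1 + t * w 1 + (v 2 + t * w 2)) ^ 2 =
          (v 1 + v 2) ^ 2 + (w 1 + w 2) ^ 2 * t ^ 2 := by
        rw [← mul_pow, ← CharTwo.add_sq]; ring
      simp only [perturb, Pi.add_apply, Pi.smul_apply, smul_eq_mul, hw0, hv, this, mul_zero,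
        add_zero, map_one, div_one, mul_one]
      rw [← tr_add]; ring_nf
    rw [h2] at h1
    rw [tr_add, mul_comm (hermForm c T v w)]
    linear_combination h1 - hv0
  obtain ⟨h1, h2⟩ := eq_zero_of_tr_eq_zero hq hF hcq key
  have hax : OnAxis w := by
    refine ⟨hw0, CharTwo.add_eq_zero.1 ?_⟩
    simpa [ha] using h2
  refine ⟨hax, ?_⟩
  rw [hermForm_of_onAxis c T v hax, hv, map_one, one_mul, CharTwo.add_eq_zero] at h1
  exact h1

/-- A point off the axis lies on at most one line of the variety, the line spanned by `v` and
`w₀`. -/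
theorem exists_common_line [Finite F] {q : ℕ} (hq : 3 < q) (hF : Nat.card F = q ^ 2)
    {c : F →+* F} (hcq : ∀ x, c x = x ^ q) (hc : ∀ x, c (c x) = x) {a T b : F} (ha : a ≠ 0)
    (hT : c T = T) (hT0 : T ≠ 0) (hb : c b ≠ b) {v : Fin 4 → F} (hv : ¬ OnAxis v) :
    ∃ w₀, ∀ w, SpanInVariety c a T v w → ∃ s t : F, w = s • v + t • w₀ := by
  by_cases h0 : v 0 = 0
  · have hU : v 1 + v 2 ≠ 0 := fun h => hv ⟨h0, CharTwo.add_eq_zero.1 h⟩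
    refine ⟨![0, 0, 0, 1], fun w h => ?_⟩
    have hw0 : w 0 = 0 := by
      -- otherwise `w` is affine, and the line meets the plane at infinity in a point of the axis
      by_contra hw0
      refine hv (span_of_affine hq hF hcq hc ha hT (v := (w 0)⁻¹ • w) (by simp [hw0]) h0 ?_).1
      intro s t
      rw [smul_smul, add_comm]
      exact h _ _
    set s := (w 1 + w 2) / (v 1 + v 2) with hs
    -- `w - s v` lies on the axis, and on the cone, hence is a multiple of the vertex
    set u := w + s • v with hu
    have hax : OnAxis u := by
      refine ⟨by simp [hu, h0, hw0], CharTwo.add_eq_zero.1 ?_⟩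
      have : s * (v 1 + v 2) = w 1 + w 2 := div_mul_cancel₀ _ hU
      simp only [hu, Pi.add_apply, Pi.smul_apply, smul_eq_mul]
      linear_combination this + CharTwo.add_self_eq_zero (w 1 + w 2)
    have hu1 : T * c (v 1 + v 2) * u 1 = 0 := by
      refine eq_zero_of_tr_mul_eq_zero hb fun t => ?_
      have h1 : quasiForm c a T (v + t • u) = 0 := by
        have := h (1 + t * s) t
        rw [hu]; convert this using 2; module
      have h2 : quasiForm c a T v = 0 := by simpa using h 1 0
      rw [quasiForm_add_of_onAxis hc hT a v (hax.smul t), h2, hermForm_smul_right,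
        hermForm_of_onAxis c T v hax, h0] at h1
      simpa using h1
    have hu1' : u 1 = 0 := by
      simpa [hT0, (map_ne_zero c).2 hU, -map_add] using hu1
    refine ⟨s, u 3, ?_⟩
    have e : w = s • v + u := by
      ext i
      simp only [hu, Pi.add_apply, Pi.smul_apply, smul_eq_mul]
      linear_combination -CharTwo.add_self_eq_zero (s * v i)
    have e' : u = u 3 • ![0, 0, 0, 1] := by
      ext i
      fin_cases i
      · simp [hax.1]
      · simp [hu1']
      · simp [← hax.2, hu1']
      · simp
    rw [← e']; exact e
  · set v' := (v 0)⁻¹ • v with hv'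
    refine ⟨![0, 1, 1, T * c (v' 1 + v' 2)], fun w h => ?_⟩
    have hv1 : v' 0 = 1 := by simp [hv', h0]
    have key := span_of_affine hq hF hcq hc ha hT (w := w + (w 0) • v') hv1
      (by simp [hv1, CharTwo.add_self_eq_zero]) (fun s t => by
        have := h (s * (v 0)⁻¹ + t * w 0 * (v 0)⁻¹) t
        rw [hv']; convert this using 2; module)
    obtain ⟨⟨k0, k2⟩, k3⟩ := key
    set u := w + (w 0) • v' with hu
    refine ⟨w 0 * (v 0)⁻¹, u 1, ?_⟩
    have e' : u = u 1 • ![0, 1, 1, T * c (v' 1 + v' 2)] := by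
      ext i
      fin_cases i
      · simp [k0]
      · simp
      · simp [← k2]
      · simp only [Fin.reduceFinMk, k3, Pi.smul_apply, smul_eq_mul]; simp [mul_comm]
    rw [← e', hu, mul_smul, ← hv']
    ext i
    simp only [Pi.add_apply, Pi.smul_apply, smul_eq_mul]
    linear_combination -CharTwo.add_self_eq_zero (w 0 * v' i)

/-- The linear form `B(v, ·)` does not vanish on the axis unless `v` lies on the axis. -/
theorem exists_hermForm_eq (c : F →+* F) {T : F} (hT0 : T ≠ 0) {v : Fin 4 → F} (hv : ¬ OnAxis v) :
    ∃ x, OnAxis x ∧ hermForm c T v x = 1 := by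
  by_cases h0 : v 0 = 0
  · have hU : v 1 + v 2 ≠ 0 := fun h => hv ⟨h0, CharTwo.add_eq_zero.1 h⟩
    have hcU := (map_ne_zero c).2 hU
    refine ⟨(T * c (v 1 + v 2))⁻¹ • ![0, 1, 1, 0], OnAxis.smul ⟨rfl, rfl⟩ _, ?_⟩
    rw [hermForm_smul_right, hermForm_of_onAxis c T _ ⟨rfl, rfl⟩]
    simp only [h0]; simp [-map_add]; field_simp
  · refine ⟨(c (v 0))⁻¹ • ![0, 0, 0, 1], OnAxis.smul ⟨rfl, rfl⟩ _, ?_⟩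
    rw [hermForm_smul_right, hermForm_of_onAxis c T _ ⟨rfl, rfl⟩]
    simp [h0]

/-- A point of the axis lies on a second line of the variety besides the axis. -/
theorem exists_span_of_onAxis
    {c : F →+* F} (hc : ∀ x, c (c x) = x) {a T b : F}
    (hT : c T = T) (hT0 : T ≠ 0) (hb : c b ≠ b) {v : Fin 4 → F} (hv : OnAxis v)
    (w₀ : Fin 4 → F) :
    ∃ w, SpanInVariety c a T v w ∧ ¬ ∃ s t : F, w = s • v + t • w₀ := by
  -- a second point of the axis
  obtain ⟨w₁, hw₁, hi⟩ : ∃ w₁ : Fin 4 → F, OnAxis w₁ ∧ ∀ k : F, w₁ ≠ k • v := by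
    by_cases h1 : v 1 = 0
    · exact ⟨![0, 1, 1, 0], ⟨rfl, rfl⟩, fun k h => by simpa [h1] using congrFun h 1⟩
    · refine ⟨![0, 0, 0, 1], ⟨rfl, rfl⟩, fun k h => ?_⟩
      have hk : k = 0 := by simpa [h1] using congrFun h 1
      simpa [hk] using congrFun h 3
  -- a point off the axis, orthogonal to `v`, and on the variety
  obtain ⟨w₂, hw₂, hn⟩ : ∃ w₂ : Fin 4 → F, SpanInVariety c a T v w₂ ∧ ¬ OnAxis w₂ := by
    obtain ⟨y, hy, hor⟩ : ∃ y : Fin 4 → F, ¬ OnAxis y ∧ hermForm c T y v = 0 := by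
      by_cases h1 : v 1 = 0
      · refine ⟨![0, 1, 0, 0], fun h => by simpa using h.2, ?_⟩
        rw [hermForm_of_onAxis c T _ hv, h1]; simp
      · refine ⟨![T * c (v 1), c (v 3), 0, 0], fun h => ?_, ?_⟩
        · have := h.1
          simp [hT0, h1] at this
        · rw [hermForm_of_onAxis c T _ hv]
          simp [hc, hT]
          linear_combination CharTwo.add_self_eq_zero (T * v 1 * v 3)
    -- a vector of the axis not orthogonal to `y` moves `y` into the variety
    obtain ⟨x, hx, hx1⟩ := exists_hermForm_eq c hT0 hy
    obtain ⟨z, hz⟩ := tr_surjective_on_fixed hc hb (conj_quasiForm hc hT a y)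
    have hzx := hx.smul z
    refine ⟨y + z • x, fun s t => ?_, fun h => hy ?_⟩
    · have e : s • v + t • (y + z • x) = t • (y + z • x) + s • v := by module
      rw [e, quasiForm_add_of_onAxis hc hT a _ (hv.smul s), quasiForm_smul hc,
        quasiForm_add_of_onAxis hc hT a _ hzx, hermForm_smul_right, hermForm_smul_right,
        hermForm_smul_left, hermForm_add_left, onAxis_isotropic c T hzx hv, hor, hx1, mul_one, hz,
        CharTwo.add_self_eq_zero]
      simp [tr]
    · have := h.add hzx
      have e : y + z • x + z • x = y := by
        ext i
        simp only [Pi.add_apply]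
        linear_combination CharTwo.add_self_eq_zero ((z • x) i)
      rwa [e] at this
  by_contra hcon
  push Not at hcon
  obtain ⟨s₁, t₁, e₁⟩ := hcon w₁ fun s t =>
    quasiForm_of_onAxis c a T ((hv.smul s).add (hw₁.smul t))
  obtain ⟨s₂, t₂, e₂⟩ := hcon w₂ hw₂
  have ht₁ : t₁ ≠ 0 := fun h => hi s₁ (by rw [e₁, h]; simp)
  have e₀ : w₀ = t₁⁻¹ • w₁ + (-(t₁⁻¹ * s₁)) • v := by
    rw [e₁, smul_add, smul_smul, smul_smul, inv_mul_cancel₀ ht₁]; module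
  apply hn
  rw [e₂, e₀]
  exact (hv.smul _).add (((hw₁.smul _).add (hv.smul _)).smul _)

end Lines

section LinearMaps

variable {F : Type*} [Field F] [CharP F 2]

/-! ### Linear maps preserving the variety -/

/-- The axis is preserved, since its points are those on several lines of the variety. -/
theorem onAxis_map [Finite F] {q : ℕ} (hq : 3 < q) (hF : Nat.card F = q ^ 2)
    {c : F →+* F} (hcq : ∀ x, c x = x ^ q) (hc : ∀ x, c (c x) = x) {a T b : F} (ha : a ≠ 0)
    (hT : c T = T) (hT0 : T ≠ 0) (hb : c b ≠ b) (g : (Fin 4 → F) ≃ₗ[F] (Fin 4 → F))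
    (hg : ∀ v, quasiForm c a T (g v) = 0 ↔ quasiForm c a T v = 0)
    {v : Fin 4 → F} (hv : OnAxis v) : OnAxis (g v) := by
  by_contra hgv
  obtain ⟨w₀, hw₀⟩ := exists_common_line hq hF hcq hc ha hT hT0 hb hgv
  obtain ⟨w, hw, hn⟩ := exists_span_of_onAxis (a := a) hc hT hT0 hb hv (g.symm w₀)
  obtain ⟨s, t, e⟩ := hw₀ (g w) fun s t => by
    rw [← map_smul, ← map_smul, ← map_add, hg]; exact hw s t
  refine hn ⟨s, t, g.injective ?_⟩
  rw [e, map_add, map_smul, map_smul, g.apply_symm_apply]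

/-- Along the translates `v + w`, `w` on the axis, the form is `Q(v) + Tr B(v, w)` with `B(v, ·)`
linear. A linear map with the same zeros therefore multiplies `Q(v)` and `B(v, ·)` by a factor. -/
theorem exists_multiplier_at {c : F →+* F} (hc : ∀ x, c (c x) = x) {a T b : F}
    (hT : c T = T) (hT0 : T ≠ 0) (hb : c b ≠ b) (g : (Fin 4 → F) ≃ₗ[F] (Fin 4 → F))
    (hg : ∀ v, quasiForm c a T (g v) = 0 ↔ quasiForm c a T v = 0)
    (hax : ∀ v, OnAxis v → OnAxis (g v)) {v : Fin 4 → F} (hv : ¬ OnAxis v) :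
    ∃ r, c r = r ∧ r ≠ 0 ∧ quasiForm c a T (g v) = r * quasiForm c a T v ∧
      ∀ w, OnAxis w → hermForm c T (g v) (g w) = r * hermForm c T v w := by
  obtain ⟨x, hx, hx1⟩ := exists_hermForm_eq c hT0 hv
  obtain ⟨z, hz⟩ := tr_surjective_on_fixed hc hb (conj_quasiForm hc hT a v)
  -- `u = z x` moves `v` into the variety
  have hu := hx.smul z
  have hQu : tr c (hermForm c T v (z • x)) = quasiForm c a T v := by
    rw [hermForm_smul_right, hx1, mul_one, hz]
  have h0 : quasiForm c a T (v + z • x) = 0 := by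
    rw [quasiForm_add_of_onAxis hc hT a v hu, hQu, CharTwo.add_self_eq_zero]
  have h0' := (hg _).2 h0
  -- the two trace functions `Tr B(v, ·)` and `Tr B(g v, g ·)` on the axis have the same zeros
  have key : ∀ w, OnAxis w →
      (tr c (hermForm c T (g v) (g w)) = 0 ↔ tr c (hermForm c T v w) = 0) := by
    intro w hw
    have h1 := hg (v + z • x + w)
    rw [map_add, quasiForm_add_of_onAxis hc hT a _ (hax w hw), h0', zero_add,
      quasiForm_add_of_onAxis hc hT a _ hw, h0, zero_add, map_add, hermForm_add_left,
      hermForm_add_left, onAxis_isotropic c T (hax _ hu) (hax _ hw),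
      onAxis_isotropic c T hu hw, add_zero, add_zero] at h1
    exact h1
  have hker : ∀ w, OnAxis w → hermForm c T v w = 0 → hermForm c T (g v) (g w) = 0 := by
    intro w hw h
    refine eq_zero_of_tr_mul_eq_zero hb fun t => ?_
    rw [← hermForm_smul_right, ← map_smul, key _ (hw.smul t), hermForm_smul_right, h, mul_zero]
    simp [tr]
  have hlin : ∀ w, OnAxis w → hermForm c T (g v) (g w) =
      hermForm c T (g v) (g x) * hermForm c T v w := by
    intro w hw
    have h1 := hker (w + hermForm c T v w • x) (hw.add (hx.smul _)) (by
      rw [hermForm_add_right, hermForm_smul_right, hx1, mul_one, CharTwo.add_self_eq_zero])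
    rw [map_add, hermForm_add_right, map_smul, hermForm_smul_right, CharTwo.add_eq_zero] at h1
    rw [h1, mul_comm]
  set r := hermForm c T (g v) (g x) with hr
  have hrc : c r = r := by
    rw [← tr_eq_zero_iff, hr, key x hx, hx1, tr_eq_zero_iff, map_one]
  refine ⟨r, hrc, fun hr0 => ?_, ?_, hlin⟩
  · have h1 := (key (b • x) (hx.smul b)).1 (by
      rw [hlin _ (hx.smul b), hr0, zero_mul]; simp [tr])
    rw [hermForm_smul_right, hx1, mul_one, tr_eq_zero_iff] at h1
    exact hb h1
  · rw [map_add, quasiForm_add_of_onAxis hc hT a _ (hax _ hu), hlin _ hu,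
      tr_mul_of_fixed hrc, hQu, CharTwo.add_eq_zero] at h0'
    exact h0'

/-- The vectors `(1, 0, 0, 0)` and `(0, 0, 1, 0)` span a complement of the axis. -/
theorem decomp_axis (v : Fin 4 → F) : v = v 0 • ![1, 0, 0, 0] + (v 1 + v 2) • ![0, 0, 1, 0] +
    ![0, v 1, v 1, v 3] := by
  ext i
  fin_cases i
  · simp
  · simp
  · simp only [Fin.reduceFinMk, Pi.add_apply, Pi.smul_apply, smul_eq_mul]
    simp
    linear_combination -CharTwo.add_self_eq_zero (v 1)
  · simp

/-- The factors of `exists_multiplier_at` agree, since `B(v, ·)` is additive in `v`. -/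
theorem exists_multiplier {c : F →+* F} (hc : ∀ x, c (c x) = x) {a T b : F}
    (hT : c T = T) (hT0 : T ≠ 0) (hb : c b ≠ b) (g : (Fin 4 → F) ≃ₗ[F] (Fin 4 → F))
    (hg : ∀ v, quasiForm c a T (g v) = 0 ↔ quasiForm c a T v = 0)
    (hax : ∀ v, OnAxis v → OnAxis (g v)) :
    ∃ r, c r = r ∧ r ≠ 0 ∧ ∀ v, quasiForm c a T (g v) = r * quasiForm c a T v := by
  have hm := fun v hv => exists_multiplier_at (v := v) hc hT hT0 hb g hg hax hv
  obtain ⟨r, hr, hr0, -, h0⟩ := hm ![1, 0, 0, 0] (fun h => one_ne_zero (h.1 : (1 : F) = 0))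
  obtain ⟨r₂, -, -, -, h2⟩ := hm ![0, 0, 1, 0] (fun h => zero_ne_one (h.2 : (0 : F) = 1))
  obtain ⟨r₃, -, -, -, h3⟩ := hm (![1, 0, 0, 0] + ![0, 0, 1, 0])
    (fun h => one_ne_zero (by simpa using h.1 : (1 : F) = 0))
  have hp : OnAxis (![0, 1, 1, 0] : Fin 4 → F) := ⟨rfl, rfl⟩
  have hz : OnAxis (![0, 0, 0, 1] : Fin 4 → F) := ⟨rfl, rfl⟩
  have hr2 : r₂ = r := by
    have e1 := h3 _ hp
    have e2 := h3 _ hz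
    rw [map_add, hermForm_add_left, h0 _ hp, h2 _ hp, hermForm_add_left] at e1
    rw [map_add, hermForm_add_left, h0 _ hz, h2 _ hz, hermForm_add_left] at e2
    simp [hermForm] at e1 e2
    rw [e2]
    exact e1.resolve_right hT0
  subst hr2
  refine ⟨r₂, hr, hr0, fun v => ?_⟩
  by_cases hv : OnAxis v
  · rw [quasiForm_of_onAxis c a T hv, quasiForm_of_onAxis c a T (hax _ hv), mul_zero]
  · obtain ⟨r₁, -, -, h1, h1'⟩ := hm v hv
    obtain ⟨x, hx, hx1⟩ := exists_hermForm_eq c hT0 hv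
    have e := h1' x hx
    have hw : OnAxis ![0, v 1, v 1, v 3] := ⟨rfl, rfl⟩
    have e2 : hermForm c T (g v) (g x) = r₂ * hermForm c T v x := by
      rw [decomp_axis v]
      simp only [map_add, map_smul, hermForm_add_left, hermForm_smul_left,
        onAxis_isotropic c T (hax _ hw) (hax _ hx), onAxis_isotropic c T hw hx, h0 _ hx, h2 _ hx]
      ring
    rw [h1, show r₁ = r₂ by rw [e, hx1, mul_one, mul_one] at e2; exact e2]

/-- The function `Tr(a u² j^(q-1))` is changed by more than a Hermitian form under a linear
substitution that does not fix `j` up to a factor: the monomial `w^(q-1)` would appear. -/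
theorem eq_zero_of_perturb_eq [Finite F] {q : ℕ} (hq : 3 < q) (hF : Nat.card F = q ^ 2)
    {c : F →+* F} (hcq : ∀ x, c x = x ^ q) (hc : ∀ x, c (c x) = x) {a r : F} (ha : a ≠ 0)
    {p s m n α β η : F} (hdet : p * n - s * m ≠ 0)
    (h : ∀ u, perturb c a (p + s * u) (m + n * u) =
      r * tr c (a * u ^ 2) + α + β * (u * c u) + tr c (u * η)) : s = 0 := by
  by_contra hs
  have hcs : c s ≠ 0 := (map_ne_zero c).2 hs
  set m' := m + n * p / s with hm'
  set n' := n / s with hn'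
  have hpow : ∀ w : F, w ^ (q - 1) = c w / w := by
    intro w
    rcases eq_or_ne w 0 with rfl | hw
    · rw [div_zero, zero_pow (by omega)]
    · rw [hcq, eq_div_iff hw, ← pow_succ]; congr 1; omega
  obtain ⟨A, hA⟩ : ∃ A, A = a / s ^ 2 := ⟨_, rfl⟩
  -- substitute `u = (w + p) / s`
  have key : ∀ w : F, tr c (a * m' ^ 2 * w ^ (q - 1)) + tr c (a * n' ^ 2) * (w * c w) =
      r * tr c (A * w ^ 2 + A * p ^ 2) + α +
        β / (s * c s) * (w * c w + tr c (w * c p) + p * c p) + tr c (w * (η / s) + p * (η / s)) := by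
    intro w
    have h1 := h ((w + p) / s)
    have e1 : p + s * ((w + p) / s) = w := by
      rw [mul_div_cancel₀ _ hs]; linear_combination CharTwo.add_self_eq_zero p
    have e2 : (m + n * ((w + p) / s)) ^ 2 = m' ^ 2 + n' ^ 2 * w ^ 2 := by
      rw [← mul_pow, ← CharTwo.add_sq, hm', hn']; ring
    have e3 : a * ((w + p) / s) ^ 2 = A * w ^ 2 + A * p ^ 2 := by
      rw [hA, div_pow, CharTwo.add_sq]; ring
    rw [e1, perturb, e2, e3, show a * (m' ^ 2 + n' ^ 2 * w ^ 2) * (c w / w) =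
      a * m' ^ 2 * (c w / w) + a * n' ^ 2 * (w * (c w)) by
        rcases eq_or_ne w 0 with rfl | hw
        · simp
        · field_simp, tr_add, ← hpow,
      show (w + p) / s * η = w * (η / s) + p * (η / s) by ring] at h1
    have e4 : tr c (a * n' ^ 2 * (w * c w)) = tr c (a * n' ^ 2) * (w * c w) := by
      rw [mul_comm, tr_mul_of_fixed (by rw [map_mul, hc, mul_comm]), mul_comm]
    rw [e4] at h1
    rw [h1]
    congr 2
    simp only [tr, map_add, map_mul, map_div₀, hc]
    field_simp
    ring
  have := coeff_eq_zero_of_forall hq hF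
    (k0 := r * tr c (A * p ^ 2) + α + β / (s * c s) * (p * c p) + tr c (p * (η / s)))
    (k1 := β / (s * c s) * c p + η / s) (k2 := r * (A)) (k3 := a * m' ^ 2)
    (k4 := β / (s * c s) * p + c (η / s)) (k5 := β / (s * c s) + tr c (a * n' ^ 2))
    (k6 := r * c (A)) (k7 := c (a * m' ^ 2)) fun w => by
      have h1 := key w
      have e1 : tr c (a * m' ^ 2 * w ^ (q - 1)) =
          a * m' ^ 2 * w ^ (q - 1) + c (a * m' ^ 2) * w ^ (q * (q - 1)) := by
        rw [tr, map_mul, map_pow, hcq w, ← pow_mul]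
      have e2 : c (w ^ 2) = w ^ (2 * q) := by rw [hcq, ← pow_mul]
      have e3 : tr c (A * w ^ 2) = A * w ^ 2 + c (A) * w ^ (2 * q) := by
        rw [tr, map_mul, e2]
      have e4 : tr c (w * c p) = w * c p + w ^ q * p := by rw [tr, map_mul, hc, hcq w]
      have e5 : tr c (w * (η / s)) = w * (η / s) + w ^ q * c (η / s) := by
        rw [tr, map_mul, hcq w]
      rw [e1, tr_add c (A * w ^ 2), tr_add c (w * (η / s)), e3, e4, e5, hcq w] at h1
      rw [pow_succ w q]
      linear_combination h1
 +        (r * tr c (A * p ^ 2) + α + β / (s * c s) * (p * c p) + tr c (p * (η / s))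
          + (β / (s * c s) * c p + η / s) * w + r * (A) * w ^ 2
          + (β / (s * c s) * p + c (η / s)) * w ^ q + β / (s * c s) * (w ^ q * w)
          + r * c (A) * w ^ (2 * q)) * CharTwo.two_eq_zero (R := F)
  -- the coefficient of `w^(q-1)`
  have hm0 : m' = 0 := by simpa [ha] using this.2.2
  apply hdet
  rw [hm'] at hm0
  field_simp at hm0
  linear_combination hm0 - CharTwo.add_self_eq_zero (s * m)

end LinearMaps

section Normalized

variable {F : Type*} [Field F] [CharP F 2]

/-! ### Maps fixing an affine point -/

/-- The factor `r` is read off from the monomial `u²`. -/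
theorem sq_eq_of_perturb_eq [Finite F] {q : ℕ} (hq : 3 < q) (hF : Nat.card F = q ^ 2)
    {c : F →+* F} (hcq : ∀ x, c x = x ^ q) {a r : F} (ha : a ≠ 0) (hr : c r = r)
    {n α β η : F}
    (h : ∀ u, tr c (a * (n * u) ^ 2) = r * tr c (a * u ^ 2) + α + β * (u * c u) + tr c (u * η)) :
    n ^ 2 = r := by
  have := coeff_eq_zero_of_forall hq hF (k0 := α) (k1 := η) (k2 := a * n ^ 2 + r * a) (k3 := 0)
    (k4 := c η) (k5 := β) (k6 := c (a * n ^ 2 + r * a)) (k7 := 0) fun w => by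
      have h1 := h w
      have e1 : tr c (a * (n * w) ^ 2) = a * n ^ 2 * w ^ 2 + c (a * n ^ 2) * w ^ (2 * q) := by
        rw [tr, mul_pow, ← mul_assoc, map_mul, map_pow, hcq w, ← pow_mul,
          mul_comm q 2]
      have e2 : tr c (a * w ^ 2) = a * w ^ 2 + c a * w ^ (2 * q) := by
        rw [tr, map_mul, map_pow, hcq w, ← pow_mul, mul_comm q 2]
      have e3 : tr c (w * η) = w * η + w ^ q * c η := by rw [tr, map_mul, hcq w]
      rw [e1, e2, e3, hcq w] at h1
      rw [map_add, map_mul c r, hr, pow_succ w q]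
      linear_combination h1 + (r * (a * w ^ 2 + c a * w ^ (2 * q)) + α + β * (w * w ^ q) +
        w * η + w ^ q * c η) * CharTwo.two_eq_zero (R := F)
  refine mul_left_cancel₀ ha (CharTwo.add_eq_zero.1 ?_)
  rw [mul_comm a r]; exact this.2.1

section Linear

variable {q : ℕ} {c : F →+* F} {a T b : F}

/-- The perturbation of `g v` on the affine line `v = (1, 0, u, 0)`. -/
theorem perturb_eq_on_line (hc : ∀ x, c (c x) = x)
    (hT : c T = T) (g : (Fin 4 → F) ≃ₗ[F] (Fin 4 → F)) {r : F}
    (hr : ∀ v, quasiForm c a T (g v) = r * quasiForm c a T v) :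
    ∃ α β η : F, ∀ u, perturb c a (g ![1, 0, 0, 0] 0 + g ![0, 0, 1, 0] 0 * u)
      (g ![1, 0, 0, 0] 1 + g ![1, 0, 0, 0] 2 + (g ![0, 0, 1, 0] 1 + g ![0, 0, 1, 0] 2) * u) =
      r * tr c (a * u ^ 2) + α + β * (u * c u) + tr c (u * η) := by
  refine ⟨hermForm c T (g ![1, 0, 0, 0]) (g ![1, 0, 0, 0]),
    r * T + hermForm c T (g ![0, 0, 1, 0]) (g ![0, 0, 1, 0]),
    hermForm c T (g ![1, 0, 0, 0]) (g ![0, 0, 1, 0]), fun u => ?_⟩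
  have h := hr (![1, 0, 0, 0] + u • ![0, 0, 1, 0])
  rw [map_add, map_smul, quasiForm, hermForm_add_smul_self hc hT] at h
  have e : quasiForm c a T (![1, 0, 0, 0] + u • ![0, 0, 1, 0]) =
      T * (u * c u) + tr c (a * u ^ 2) := by
    simp [quasiForm, hermForm, perturb]
    exact Or.inl (mul_comm _ _)
  rw [e] at h
  simp only [Pi.add_apply, Pi.smul_apply, smul_eq_mul] at h
  have e2 : ∀ x y : F, x + u * y = x + y * u := fun x y => by ring
  have e3 : ∀ x y z t : F, x + u * y + (z + u * t) = x + z + (y + t) * u := fun x y z t => by ring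
  rw [e2, e3] at h
  linear_combination h - (hermForm c T (g ![1, 0, 0, 0]) (g ![1, 0, 0, 0]) +
    u * c u * hermForm c T (g ![0, 0, 1, 0]) (g ![0, 0, 1, 0]) +
    tr c (u * hermForm c T (g ![1, 0, 0, 0]) (g ![0, 0, 1, 0]))) * CharTwo.two_eq_zero (R := F)

/-- A linear map preserving the variety fixes the plane at infinity. -/
theorem map_apply_zero [Finite F] (hq : 3 < q) (hF : Nat.card F = q ^ 2)
    (hcq : ∀ x, c x = x ^ q) (hc : ∀ x, c (c x) = x) (ha : a ≠ 0)
    (hT : c T = T) (hT0 : T ≠ 0) (hb : c b ≠ b) (g : (Fin 4 → F) ≃ₗ[F] (Fin 4 → F))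
    (hg : ∀ v, quasiForm c a T (g v) = 0 ↔ quasiForm c a T v = 0) :
    g ![1, 0, 0, 0] 0 ≠ 0 ∧ ∀ v, g v 0 = g ![1, 0, 0, 0] 0 * v 0 := by
  have hax := fun v hv => onAxis_map (v := v) hq hF hcq hc ha hT hT0 hb g hg hv
  have hax' : ∀ v, OnAxis (g v) → OnAxis v := fun v hv => by
    have := onAxis_map hq hF hcq hc ha hT hT0 hb g.symm (fun v => by
      rw [← hg, g.apply_symm_apply]) hv
    rwa [g.symm_apply_apply] at this
  obtain ⟨r, -, -, hr⟩ := exists_multiplier hc hT hT0 hb g hg hax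
  obtain ⟨α, β, η, h⟩ := perturb_eq_on_line hc hT g hr
  set p := g ![1, 0, 0, 0] 0 with hp
  set s := g ![0, 0, 1, 0] 0 with hs
  set m := g ![1, 0, 0, 0] 1 + g ![1, 0, 0, 0] 2 with hm
  set n := g ![0, 0, 1, 0] 1 + g ![0, 0, 1, 0] 2 with hn
  have hcomb : ∀ x y : F, x * p + y * s = 0 → x * m + y * n = 0 → x = 0 ∧ y = 0 := by
    intro x y h1 h2
    have := hax' (x • ![1, 0, 0, 0] + y • ![0, 0, 1, 0]) (by
      rw [map_add, map_smul, map_smul]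
      refine ⟨by simpa using h1, CharTwo.add_eq_zero.1 ?_⟩
      simp only [Pi.add_apply, Pi.smul_apply, smul_eq_mul]
      linear_combination h2)
    have h3 := this.1
    have h4 := this.2
    simp at h3 h4
    exact ⟨h3, h4.symm⟩
  -- otherwise a vector off the axis would be mapped to the axis
  have hdet : p * n - s * m ≠ 0 := by
    intro h0
    obtain ⟨hs0, hp0⟩ := hcomb s (-p) (by ring) (by linear_combination -h0)
    obtain ⟨hn0, hm0⟩ := hcomb n (-m) (by linear_combination h0) (by ring)
    rw [neg_eq_zero] at hp0 hm0
    exact one_ne_zero (hcomb 1 1 (by simp [hs0, hp0]) (by simp [hn0, hm0])).1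
  have hs0 : s = 0 := eq_zero_of_perturb_eq hq hF hcq hc ha hdet h
  refine ⟨fun hp0 => hdet (by rw [hp0, hs0]; ring), fun v => ?_⟩
  have hw : OnAxis ![0, v 1, v 1, v 3] := ⟨rfl, rfl⟩
  conv_lhs => rw [decomp_axis v]
  rw [map_add, map_add, map_smul, map_smul]
  simp only [Pi.add_apply, Pi.smul_apply, smul_eq_mul, (hax _ hw).1, ← hp, ← hs, hs0]
  ring

/-- The linear maps that preserve the variety and fix `(1, 0, 0, 0)`: the monomial `u²` shows that
they are similitudes of the Hermitian form, and they preserve `X + Y` up to a factor. -/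
theorem eq_mu_tau [Finite F] (hq : 3 < q) (hF : Nat.card F = q ^ 2)
    (hcq : ∀ x, c x = x ^ q) (hc : ∀ x, c (c x) = x) (ha : a ≠ 0)
    (hT : c T = T) (hT0 : T ≠ 0) (hb : c b ≠ b) (g : (Fin 4 → F) ≃ₗ[F] (Fin 4 → F))
    (hg : ∀ v, quasiForm c a T (g v) = 0 ↔ quasiForm c a T v = 0)
    (hg0 : g ![1, 0, 0, 0] = ![1, 0, 0, 0]) :
    ∃ δ e : F, c δ = δ ∧ δ ≠ 0 ∧ c e = e ∧ ∀ v, g v = v ᵥ* (muMat δ * tauMat e) := by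
  have hax := fun v hv => onAxis_map (v := v) hq hF hcq hc ha hT hT0 hb g hg hv
  obtain ⟨r, hrc, hr0, hr⟩ := exists_multiplier hc hT hT0 hb g hg hax
  obtain ⟨α, β, η, h⟩ := perturb_eq_on_line hc hT g hr
  have hJ := (map_apply_zero hq hF hcq hc ha hT hT0 hb g hg).2
  have hJ' : ∀ v, g v 0 = v 0 := fun v => by rw [hJ, hg0]; simp
  set n := g ![0, 0, 1, 0] 1 + g ![0, 0, 1, 0] 2 with hn
  have hnr : n ^ 2 = r := by
    refine sq_eq_of_perturb_eq hq hF hcq ha hrc (fun u => ?_) (α := α) (β := β) (η := η)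
    rw [← h u, hJ', hJ' ![0, 0, 1, 0], hg0]
    simp [perturb]
  have hnc : c n = n := sq_injective (by rw [← map_pow, hnr, hrc])
  have hn0 : n ≠ 0 := fun h0 => hr0 (by rw [← hnr, h0]; ring)
  -- `g` multiplies `X + Y` by `n`, and fixes `J`, hence multiplies the perturbation by `r`
  have hU : ∀ v, g v 1 + g v 2 = n * (v 1 + v 2) := by
    intro v
    have hw : OnAxis ![0, v 1, v 1, v 3] := ⟨rfl, rfl⟩
    conv_lhs => rw [decomp_axis v]
    rw [map_add, map_add, map_smul, map_smul, hg0]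
    have h2 := (hax _ hw).2
    simp only [Pi.add_apply, Pi.smul_apply, smul_eq_mul, h2]
    simp
    linear_combination -(v 1 + v 2) * hn + CharTwo.add_self_eq_zero (g ![0, v 1, v 1, v 3] 2)
  have hdiag : ∀ v, hermForm c T (g v) (g v) = r * hermForm c T v v := by
    intro v
    have h1 := hr v
    rw [quasiForm, quasiForm, hJ', hU] at h1
    have : perturb c a (v 0) (n * (v 1 + v 2)) = r * perturb c a (v 0) (v 1 + v 2) := by
      rw [perturb, perturb, ← tr_mul_of_fixed hrc, ← hnr]; congr 1; ring
    rw [this] at h1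
    linear_combination h1
  have hB : ∀ v w, hermForm c T (g v) (g w) = r * hermForm c T v w := by
    intro v w
    refine CharTwo.add_eq_zero.1 (eq_zero_of_tr_mul_eq_zero hb fun t => ?_)
    have h1 := hdiag (v + t • w)
    rw [map_add, map_smul, hermForm_add_smul_self hc hT, hermForm_add_smul_self hc hT, hdiag,
      hdiag] at h1
    rw [mul_add, tr_add, mul_left_comm, tr_mul_of_fixed hrc]
    linear_combination h1 + r * tr c (t * hermForm c T v w) * CharTwo.two_eq_zero (R := F)
  -- pairing with `(1, 0, 0, 0)` gives the last coordinate
  have hZ : ∀ v, g v 3 = r * v 3 := by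
    intro v
    have h1 := hB ![1, 0, 0, 0] v
    rw [hg0] at h1
    simpa [hermForm] using h1
  have h3 : g ![0, 0, 0, 1] 1 = 0 := by
    have h1 := hB ![0, 0, 1, 0] ![0, 0, 0, 1]
    rw [hermForm_of_onAxis c T _ (hax _ ⟨rfl, rfl⟩), hU, hJ'] at h1
    simpa [hermForm, hT0, hn0] using h1
  have h3' : g ![0, 0, 0, 1] 2 = 0 := by
    rw [← (hax ![0, 0, 0, 1] ⟨rfl, rfl⟩).2, h3]
  -- the restriction to the `X`, `Y` coordinates
  have h22 := hB ![0, 0, 1, 0] ![0, 0, 1, 0]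
  have h11 := hB ![0, 1, 0, 0] ![0, 1, 0, 0]
  have h12 := hB ![0, 1, 0, 0] ![0, 0, 1, 0]
  have hU1 := hU ![0, 1, 0, 0]
  have hU2 := hU ![0, 0, 1, 0]
  set x := g ![0, 1, 0, 0] 1 with hx
  set y := g ![0, 0, 1, 0] 1 with hy
  have ex : g ![0, 1, 0, 0] 2 = n + x := by
    rw [CharTwo.eq_add_iff_add_eq, add_comm, hU1]; simp
  have ey : g ![0, 0, 1, 0] 2 = n + y := by
    rw [CharTwo.eq_add_iff_add_eq, add_comm, hU2]; simp
  simp only [hermForm, hJ', hZ, ← hx, ← hy, ex, ey] at h11 h12 h22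
  simp [hnc, hT0, ← hnr] at h11 h12 h22
  have hyc : c y = y := by
    refine CharTwo.add_eq_zero.1 (mul_left_cancel₀ hn0 (mul_left_cancel₀ hT0 ?_))
    linear_combination h22 - T * c y * y * CharTwo.two_eq_zero (R := F)
  have hxy : x + y = n := by
    have hxc : c x = x := by
      refine CharTwo.add_eq_zero.1 (mul_left_cancel₀ hn0 (mul_left_cancel₀ hT0 ?_))
      linear_combination h11 - T * c x * x * CharTwo.two_eq_zero (R := F)
    rw [hxc] at h12
    refine CharTwo.add_eq_zero.1 (mul_left_cancel₀ hn0 ?_)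
    linear_combination h12 - x * y * CharTwo.two_eq_zero (R := F)
  refine ⟨n, y / n, hnc, hn0, by rw [map_div₀, hyc, hnc], fun v => ?_⟩
  have ev : v = v 0 • ![1, 0, 0, 0] + v 1 • ![0, 1, 0, 0] + v 2 • ![0, 0, 1, 0] +
      v 3 • ![0, 0, 0, 1] := by
    ext i; fin_cases i <;> simp
  have eg : ∀ i, g v i = v 0 * (![1, 0, 0, 0] : Fin 4 → F) i + v 1 * g ![0, 1, 0, 0] i +
      v 2 * g ![0, 0, 1, 0] i + v 3 * g ![0, 0, 0, 1] i := fun i => by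
    conv_lhs => rw [ev]
    simp only [map_add, map_smul, hg0, Pi.add_apply, Pi.smul_apply, smul_eq_mul]
  have exy : x = y + n := by rw [← hxy]; linear_combination -CharTwo.add_self_eq_zero y
  have hM : muMat n * tauMat (y / n) =
      !![1, 0, 0, 0; 0, y + n, y, 0; 0, y, y + n, 0; 0, 0, 0, n ^ 2] := by
    ext i j
    fin_cases i <;> fin_cases j <;>
      simp [muMat, tauMat, Matrix.mul_apply, Fin.sum_univ_four] <;> field_simp
  rw [hM]
  ext i
  fin_cases i
  · simp [hJ', Matrix.vecMul, dotProduct, Fin.sum_univ_four]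
  · change g v 1 = _
    rw [eg]
    simp [← hx, ← hy, h3, Matrix.vecMul, dotProduct, Fin.sum_univ_four, exy]
  · change g v 2 = _
    rw [eg]
    simp [ex, ey, h3', Matrix.vecMul, dotProduct, Fin.sum_univ_four, exy]
    linear_combination v 1 * n * CharTwo.two_eq_zero (R := F)
  · simp [hZ, hnr, Matrix.vecMul, dotProduct, Fin.sum_univ_four, mul_comm]

end Linear

end Normalized

section Collineations

variable {F : Type*} [Field F]

/-! ### Collineations and the zeros of the form -/

theorem semilinearMap_apply (M : GL (Fin 4) F) (θ : F ≃+* F) (v : Fin 4 → F) :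
    semilinearMap M θ v = (fun i => θ (v i)) ᵥ* (M : Matrix (Fin 4) (Fin 4) F) := rfl

theorem semilinearMap_refl (M : GL (Fin 4) F) (v : Fin 4 → F) :
    semilinearMap M (RingEquiv.refl F) v = v ᵥ* (M : Matrix (Fin 4) (Fin 4) F) := rfl

theorem collineation_mk (M : GL (Fin 4) F) (θ : F ≃+* F) (v : Fin 4 → F) (hv : v ≠ 0) :
    collineation M θ (Projectivization.mk F v hv) =
      Projectivization.mk F (semilinearMap M θ v)
        ((map_ne_zero_iff _ (semilinearMap_injective M θ)).2 hv) := rfl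

theorem collineation_eq_of_smul {M N : GL (Fin 4) F} {θ : F ≃+* F} {k : F}
    (h : ∀ v, semilinearMap M θ v = k • semilinearMap N θ v) :
    collineation M θ = collineation N θ := by
  ext P
  induction P using Projectivization.ind with
  | h v hv =>
    rw [collineation_mk, collineation_mk, Projectivization.mk_eq_mk_iff']
    exact ⟨k, (h v).symm⟩

/-- A collineation determines its field automorphism, and its matrix up to a factor. -/
theorem collineation_eq {M N : GL (Fin 4) F} {θ η : F ≃+* F}
    (h : collineation M θ = collineation N η) :
    θ = η ∧ ∃ k : F, (M : Matrix (Fin 4) (Fin 4) F) = k • (N : Matrix (Fin 4) (Fin 4) F) := by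
  classical
  have h1 : ∀ v : Fin 4 → F, v ≠ 0 → ∃ k : F, semilinearMap M θ v = k • semilinearMap N η v := by
    intro v hv
    have := DFunLike.congr_fun h (Projectivization.mk F v hv)
    rw [collineation_mk, collineation_mk, Projectivization.mk_eq_mk_iff'] at this
    obtain ⟨k, hk⟩ := this
    exact ⟨k, hk.symm⟩
  have hs : ∀ i, (Pi.single i 1 : Fin 4 → F) ≠ 0 := fun i => by simp
  choose k hk using fun i => h1 _ (hs i)
  -- compare the images of the basis vectors `eᵢ` and of the vectors `eᵢ + t eⱼ`
  have hone : ∀ (θ : F ≃+* F) (i : Fin 4), (fun j => θ ((Pi.single i 1 : Fin 4 → F) j)) =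
      Pi.single i 1 := by
    intro θ i; ext j
    by_cases hj : j = i
    · subst hj; simp
    · simp [hj]
  have hrow : ∀ i, (M : Matrix (Fin 4) (Fin 4) F) i = k i • (N : Matrix (Fin 4) (Fin 4) F) i := by
    intro i
    have := hk i
    rw [semilinearMap_apply, semilinearMap_apply, hone, hone, Matrix.single_one_vecMul,
      Matrix.single_one_vecMul] at this
    exact this
  have key : ∀ (i j : Fin 4), i ≠ j → ∀ t : F, k j * θ t = k i * η t := by
    intro i j hij t
    have hv : (Pi.single i 1 + t • Pi.single j 1 : Fin 4 → F) ≠ 0 := fun h => by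
      simpa [hij] using congrFun h i
    obtain ⟨l, hl⟩ := h1 _ hv
    rw [map_add, map_add, map_smulₛₗ, map_smulₛₗ, hk, hk] at hl
    have hone' : ∀ i, semilinearMap N η (Pi.single i 1) =
        (Pi.single i 1 : Fin 4 → F) ᵥ* (N : Matrix (Fin 4) (Fin 4) F) := fun i => by
      rw [semilinearMap_apply, hone]
    rw [hone', hone'] at hl
    have h2 : (k i • Pi.single i 1 + (θ t * k j) • Pi.single j 1 : Fin 4 → F) ᵥ*
        (N : Matrix (Fin 4) (Fin 4) F) = (l • Pi.single i 1 + (l * η t) • Pi.single j 1) ᵥ*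
        (N : Matrix (Fin 4) (Fin 4) F) := by
      simp only [Matrix.add_vecMul, Matrix.smul_vecMul]
      simpa [smul_add, smul_smul] using hl
    have h3 := Matrix.vecMul_injective_of_isUnit N.isUnit h2
    have hi := congrFun h3 i
    have hj := congrFun h3 j
    simp [hij, hij.symm] at hi hj
    rw [hi, mul_comm, hj]
  have hk0 : k 0 ≠ 0 := by
    intro h0
    have h2 := hk 0
    rw [h0, zero_smul] at h2
    exact (map_ne_zero_iff _ (semilinearMap_injective M θ)).2 (hs 0) h2
  have hkk : ∀ j, k j = k 0 := by
    intro j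
    by_cases hj : j = 0
    · rw [hj]
    · simpa using key 0 j (Ne.symm hj) 1
  refine ⟨?_, k 0, ?_⟩
  · ext t
    have := key 0 1 (by decide) t
    rw [hkk 1] at this
    exact mul_left_cancel₀ hk0 this
  · ext i j
    rw [hrow i, hkk i]; rfl

theorem mem_stabilizer_varietyM_iff (q : ℕ) (a b : F) (g : Equiv.Perm (PG3 F)) :
    g ∈ MulAction.stabilizer (Equiv.Perm (PG3 F)) (varietyM q a b) ↔
      g '' varietyM q a b = varietyM q a b := Iff.rfl

section Variety

variable [CharP F 2] {q : ℕ} {c : F →+* F}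

/-- At `J ≠ 0`, the equation of the surface is `J^(q-1) Q(v) = 0`. -/
theorem surface_equation_iff (hq : 0 < q) (hcq : ∀ x, c x = x ^ q) (hc : ∀ x, c (c x) = x)
    (a b : F) {v : Fin 4 → F} (h0 : v 0 ≠ 0) :
    (v 3 ^ q * v 0 ^ q - v 3 * v 0 ^ (2 * q - 1) + a ^ q * (v 1 ^ (2 * q) + v 2 ^ (2 * q))
        - a * (v 1 ^ 2 + v 2 ^ 2) * v 0 ^ (2 * q - 2)
      = (b ^ q - b) * (v 1 ^ (q + 1) + v 2 ^ (q + 1)) * v 0 ^ (q - 1)) ↔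
      quasiForm c a (b + b ^ q) v = 0 := by
  have hc0 : c (v 0) ≠ 0 := (map_ne_zero c).2 h0
  have e1 : v 0 ^ (q - 1) = c (v 0) / v 0 := by
    rw [hcq, eq_div_iff h0, ← pow_succ]; congr 1; omega
  have e2 : v 0 ^ (2 * q - 2) = (c (v 0) / v 0) ^ 2 := by
    rw [← e1, ← pow_mul]; congr 1; omega
  have e3 : v 0 ^ (2 * q - 1) = c (v 0) * (c (v 0) / v 0) := by
    rw [← e1, hcq, ← pow_add]; congr 1; omega
  have e4 : ∀ x : F, x ^ (2 * q) = c x ^ 2 := fun x => by rw [hcq, ← pow_mul, mul_comm]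
  have e5 : ∀ x : F, x ^ (q + 1) = c x * x := fun x => by rw [hcq, pow_succ]
  rw [e1, e2, e3, e4, e4, e5, e5, ← hcq, ← hcq, ← hcq]
  have hne : c (v 0) / v 0 ≠ 0 := div_ne_zero hc0 h0
  rw [← sub_eq_zero, ← mul_eq_zero_iff_left hne (b := quasiForm _ _ _ _)]
  apply Eq.congr _ rfl
  have e6 : (v 1 + v 2) ^ 2 = v 1 ^ 2 + v 2 ^ 2 := CharTwo.add_sq _ _
  simp only [quasiForm, hermForm, perturb, tr, e6, map_mul, map_add, map_pow, map_div₀, hc]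
  simp only [CharTwo.sub_eq_add]
  field_simp
  ring

/-- The points of `M_{a,b}` are the zeros of the form; at `J = 0` the form is `T (N X + N Y)`,
which defines the cone at infinity. -/
theorem mk_mem_varietyM_iff (hq : 0 < q) (hcq : ∀ x, c x = x ^ q) (hc : ∀ x, c (c x) = x)
    (a : F) {b : F} (hb : c b ≠ b) (v : Fin 4 → F) (hv : v ≠ 0) :
    Projectivization.mk F v hv ∈ varietyM q a b ↔ quasiForm c a (b + b ^ q) v = 0 := by
  have hT0 : b + b ^ q ≠ 0 := fun h => hb (by
    rw [hcq]; exact (CharTwo.add_eq_zero.1 h).symm)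
  have hcone : ∀ w : Fin 4 → F, w 0 = 0 →
      (w 1 ^ (q + 1) + w 2 ^ (q + 1) = 0 ↔ quasiForm c a (b + b ^ q) w = 0) := by
    intro w hw
    have : quasiForm c a (b + b ^ q) w = (b + b ^ q) * (w 1 ^ (q + 1) + w 2 ^ (q + 1)) := by
      simp only [quasiForm, hermForm, perturb, tr, hw, div_zero, pow_succ _ q, ← hcq]
      simp
    rw [this, mul_eq_zero, or_iff_right hT0]
  have htrans : ∀ (w : Fin 4 → F) (hw : w ≠ 0),
      Projectivization.mk F v hv = Projectivization.mk F w hw →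
      quasiForm c a (b + b ^ q) w = 0 → quasiForm c a (b + b ^ q) v = 0 := by
    intro w hw h h1
    obtain ⟨k, rfl⟩ := (Projectivization.mk_eq_mk_iff' F _ _ hv hw).1 h
    rw [quasiForm_smul hc, h1, mul_zero]
  have hinf : ∀ (w : Fin 4 → F) (hw : w ≠ 0),
      Projectivization.mk F w hw ∈ planeAtInfinity F ↔ w 0 = 0 := by
    intro w hw
    refine ⟨?_, fun h => ⟨w, hw, rfl, h⟩⟩
    rintro ⟨u, hu, h, h0⟩
    obtain ⟨k, rfl⟩ := (Projectivization.mk_eq_mk_iff' F _ _ hw hu).1 h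
    simp [h0]
  constructor
  · rintro (⟨⟨w, hw, hvw, h⟩, hn⟩ | ⟨w, hw, hvw, h0, h⟩)
    · have h0 : w 0 ≠ 0 := by
        intro h0
        exact hn ⟨⟨w, hw, hvw, h⟩, w, hw, hvw, h0⟩
      exact htrans w hw hvw ((surface_equation_iff hq hcq hc a b h0).1 h)
    · exact htrans w hw hvw ((hcone w h0).1 h)
  · intro h
    by_cases h0 : v 0 = 0
    · exact Or.inr ⟨v, hv, rfl, h0, (hcone v h0).2 h⟩
    · refine Or.inl ⟨⟨v, hv, rfl, (surface_equation_iff hq hcq hc a b h0).2 h⟩, fun hi => h0 ?_⟩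
      exact (hinf v hv).1 hi.2

theorem image_varietyM_iff (hq : 0 < q) (hcq : ∀ x, c x = x ^ q) (hc : ∀ x, c (c x) = x)
    {a b a' b' : F} (hb : c b ≠ b) (hb' : c b' ≠ b') (M : GL (Fin 4) F) (θ : F ≃+* F) :
    collineation M θ '' varietyM q a b = varietyM q a' b' ↔
      ∀ v, quasiForm c a' (b' + b' ^ q) (semilinearMap M θ v) = 0 ↔
        quasiForm c a (b + b ^ q) v = 0 := by
  have h1 : collineation M θ '' varietyM q a b = varietyM q a' b' ↔
      ∀ P, collineation M θ P ∈ varietyM q a' b' ↔ P ∈ varietyM q a b := by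
    constructor
    · intro h P
      rw [← h, (collineation M θ).injective.mem_set_image]
    · intro h
      ext P
      obtain ⟨P, rfl⟩ := (collineation M θ).surjective P
      rw [h, (collineation M θ).injective.mem_set_image]
  rw [h1]
  constructor
  · intro h v
    rcases eq_or_ne v 0 with rfl | hv
    · rw [map_zero, quasiForm_zero, quasiForm_zero]
    · rw [← mk_mem_varietyM_iff hq hcq hc a hb v hv, ← h, collineation_mk,
        mk_mem_varietyM_iff hq hcq hc a' hb']
  · intro h P
    induction P using Projectivization.ind with
    | h v hv =>
      rw [collineation_mk, mk_mem_varietyM_iff hq hcq hc a' hb',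
        mk_mem_varietyM_iff hq hcq hc a hb, h]

end Variety

/-! ### The projectivities of the variety -/

/-- A matrix with nonzero determinant as an element of the general linear group. -/
noncomputable abbrev toGL (M : Matrix (Fin 4) (Fin 4) F) (h : M.det ≠ 0) : GL (Fin 4) F :=
  Matrix.GeneralLinearGroup.mkOfDetNeZero M h

theorem det_phiMat (s : F) : (phiMat s).det ≠ 0 := by
  simp [phiMat, Matrix.det_succ_row_zero, Fin.sum_univ_succ]

theorem det_psiMat (q : ℕ) (a b γ₁ γ₂ : F) : (psiMat q a b γ₁ γ₂).det ≠ 0 := by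
  simp [psiMat, Matrix.det_succ_row_zero, Fin.sum_univ_succ]

theorem det_muMat {δ : F} (hδ : δ ≠ 0) : (muMat δ).det ≠ 0 := by
  simp [muMat, Matrix.det_succ_row_zero, Fin.sum_univ_succ, hδ]

theorem quasiForm_mu {c : F →+* F} {δ : F} (hδ : c δ = δ) (a T : F) (v : Fin 4 → F) :
    quasiForm c a T (v ᵥ* muMat δ) = δ ^ 2 * quasiForm c a T v := by
  have e1 : v ᵥ* muMat δ = ![v 0, δ * v 1, δ * v 2, δ ^ 2 * v 3] := by
    ext i
    fin_cases i <;> simp [muMat, Matrix.vecMul, dotProduct, Fin.sum_univ_four, mul_comm]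
  rw [e1]
  have hp : perturb c a (v 0) (δ * v 1 + δ * v 2) = δ ^ 2 * perturb c a (v 0) (v 1 + v 2) := by
    rw [perturb, perturb, ← tr_mul_of_fixed (by rw [map_pow, hδ])]; congr 1; ring
  simp [quasiForm, hermForm, hδ, hp]
  ring

variable [CharP F 2] {q : ℕ} {c : F →+* F}

theorem det_tauMat (e : F) : (tauMat e).det ≠ 0 := by
  have : (tauMat e).det = 1 := by
    simp [tauMat, Matrix.det_succ_row_zero, Fin.sum_univ_succ]
    linear_combination e * CharTwo.two_eq_zero (R := F)
  rw [this]; exact one_ne_zero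

theorem quasiForm_phi {s : F} (hs : c s = s) (a T : F) (v : Fin 4 → F) :
    quasiForm c a T (v ᵥ* phiMat s) = quasiForm c a T v := by
  simp [quasiForm, hermForm, Matrix.vecMul, dotProduct, Fin.sum_univ_four, phiMat, hs]
  linear_combination c (v 0) * v 0 * s * CharTwo.two_eq_zero (R := F)

theorem quasiForm_psi (hcq : ∀ x, c x = x ^ q) (hc : ∀ x, c (c x) = x) (a b γ₁ γ₂ : F)
    (v : Fin 4 → F) :
    quasiForm c a (b + b ^ q) (v ᵥ* psiMat q a b γ₁ γ₂) = quasiForm c a (b + b ^ q) v := by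
  have e : v ᵥ* psiMat q a b γ₁ γ₂ = ![v 0, v 1 + v 0 * γ₁, v 2 + v 0 * γ₂,
      v 3 + v 0 * (a * (γ₁ ^ 2 + γ₂ ^ 2) + b * (c γ₁ * γ₁ + c γ₂ * γ₂)) +
        (b + c b) * (v 1 * c γ₁ + v 2 * c γ₂)] := by
    ext i
    fin_cases i <;>
      simp [psiMat, Matrix.vecMul, dotProduct, Fin.sum_univ_four, hcq, pow_succ,
        CharTwo.two_eq_zero] <;> ring
  rw [e, ← hcq]
  rcases eq_or_ne (v 0) 0 with h0 | h0
  · simp [quasiForm, hermForm, perturb, h0]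
  have hc0 : c (v 0) ≠ 0 := (map_ne_zero c).2 h0
  simp [quasiForm, hermForm, perturb, tr, hc]
  field_simp
  have h2 := CharTwo.two_eq_zero (R := F)
  ring_nf
  simp only [h2, mul_zero, add_zero]

theorem quasiForm_tau {e : F} (he : c e = e) (a T : F) (v : Fin 4 → F) :
    quasiForm c a T (v ᵥ* tauMat e) = quasiForm c a T v := by
  have h2 := CharTwo.two_eq_zero (R := F)
  have e1 : v ᵥ* tauMat e =
      ![v 0, v 1 + e * (v 1 + v 2), v 2 + e * (v 1 + v 2), v 3] := by
    ext i
    fin_cases i <;> simp [tauMat, Matrix.vecMul, dotProduct, Fin.sum_univ_four] <;> ring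
  have e2 : v 1 + e * (v 1 + v 2) + (v 2 + e * (v 1 + v 2)) = v 1 + v 2 := by
    linear_combination e * (v 1 + v 2) * h2
  rw [e1]
  simp only [quasiForm, hermForm]
  simp [e2, he]
  left
  linear_combination e * (1 + e) * (v 1 + v 2) * (c (v 1) + c (v 2)) * h2

end Collineations

section Stabilizer

variable {F : Type*} [Field F]

/-! ### The linear stabilizer -/

/-- The linear automorphism `v ↦ v M` of the space of row vectors. -/
noncomputable def rowEquiv (M : GL (Fin 4) F) : (Fin 4 → F) ≃ₗ[F] (Fin 4 → F) :=
  LinearEquiv.ofBijective (Matrix.vecMulLinear (M : Matrix (Fin 4) (Fin 4) F))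
    ⟨Matrix.vecMul_injective_of_isUnit M.isUnit, Matrix.vecMul_surjective_iff_isUnit.2 M.isUnit⟩

theorem rowEquiv_apply (M : GL (Fin 4) F) (v : Fin 4 → F) :
    rowEquiv M v = v ᵥ* (M : Matrix (Fin 4) (Fin 4) F) := rfl

theorem collineation_refl_mul (M N : GL (Fin 4) F) :
    collineation N (RingEquiv.refl F) * collineation M (RingEquiv.refl F) =
      collineation (M * N) (RingEquiv.refl F) := by
  rw [collineation_mul]
  rfl

theorem row_psi (q : ℕ) (a b γ₁ γ₂ : F) : ![1, 0, 0, 0] ᵥ* psiMat q a b γ₁ γ₂ =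
    ![1, γ₁, γ₂, a * (γ₁ ^ 2 + γ₂ ^ 2) + b * (γ₁ ^ (q + 1) + γ₂ ^ (q + 1))] := by
  ext i
  fin_cases i <;> simp [psiMat]

section GStab

variable [CharP F 2] {q : ℕ} {c : F →+* F}

theorem mem_GStab_iff (hq : 0 < q) (hcq : ∀ x, c x = x ^ q) (hc : ∀ x, c (c x) = x)
    {a b : F} (hb : c b ≠ b) (M : GL (Fin 4) F) :
    collineation M (RingEquiv.refl F) ∈ GStab q a b ↔
      ∀ v, quasiForm c a (b + b ^ q) (v ᵥ* (M : Matrix (Fin 4) (Fin 4) F)) = 0 ↔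
        quasiForm c a (b + b ^ q) v = 0 := by
  rw [GStab, Subgroup.mem_inf, mem_stabilizer_varietyM_iff, image_varietyM_iff hq hcq hc hb hb,
    and_iff_right ⟨M, rfl⟩]
  rfl

theorem linearGenerators_subset (hq : 0 < q) (hcq : ∀ x, c x = x ^ q) (hc : ∀ x, c (c x) = x)
    (a : F) {b : F} (hb : c b ≠ b) :
    linearGenerators q a b ⊆ (GStab q a b : Set (Equiv.Perm (PG3 F))) := by
  rintro _ ⟨A, rfl, h⟩
  rw [SetLike.mem_coe, mem_GStab_iff hq hcq hc hb]
  intro v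
  rcases h with ⟨s, hs, h⟩ | ⟨γ₁, γ₂, h⟩ | ⟨e, he, h⟩ | ⟨δ, hδ, hδ0, h⟩
  · rw [h, quasiForm_phi (by rw [hcq, hs])]
  · rw [h, quasiForm_psi hcq hc]
  · rw [h, quasiForm_tau (by rw [hcq, he])]
  · rw [h, quasiForm_mu (by rw [hcq, hδ])]
    simp [hδ0]

/-- The parameters `(s, γ₁, γ₂, e, δ)` of an element of the linear stabilizer. -/
abbrev Param (F : Type*) [Field F] (q : ℕ) : Type _ :=
  {s : F // s ^ q = s} × F × F × {e : F // e ^ q = e} × {δ : F // δ ^ q = δ ∧ δ ≠ 0}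

/-- The projectivity `μ_δ`, followed by `τ_e`, `ψ_γ` and `φ_s`. -/
noncomputable def paramGL (q : ℕ) (a b : F) (x : Param F q) : GL (Fin 4) F :=
  toGL (muMat x.2.2.2.2.1) (det_muMat x.2.2.2.2.2.2) * toGL (tauMat x.2.2.2.1.1) (det_tauMat _) *
    (toGL (psiMat q a b x.2.1 x.2.2.1) (det_psiMat _ _ _ _ _) *
      toGL (phiMat x.1.1) (det_phiMat _))

theorem paramGL_mem_closure (q : ℕ) (a b : F) (x : Param F q) :
    collineation (paramGL q a b x) (RingEquiv.refl F) ∈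
      Subgroup.closure (linearGenerators q a b) := by
  rw [paramGL, ← collineation_refl_mul, ← collineation_refl_mul, ← collineation_refl_mul]
  refine mul_mem (mul_mem ?_ ?_) (mul_mem ?_ ?_) <;> apply Subgroup.subset_closure
  · exact ⟨_, rfl, Or.inl ⟨_, x.1.2, rfl⟩⟩
  · exact ⟨_, rfl, Or.inr (Or.inl ⟨_, _, rfl⟩)⟩
  · exact ⟨_, rfl, Or.inr (Or.inr (Or.inl ⟨_, x.2.2.2.1.2, rfl⟩))⟩
  · exact ⟨_, rfl, Or.inr (Or.inr (Or.inr ⟨_, x.2.2.2.2.2.1, x.2.2.2.2.2.2, rfl⟩))⟩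

/-- The translations `ψ_γ φ_s` are transitive on the affine points of the variety, and the
stabilizer of `(1, 0, 0, 0)` is known from `eq_mu_tau`. -/
theorem exists_param [Finite F] (hq : 3 < q) (hF : Nat.card F = q ^ 2)
    (hcq : ∀ x, c x = x ^ q) (hc : ∀ x, c (c x) = x)
    {a b : F} (ha : a ≠ 0) (hb : c b ≠ b) {g : Equiv.Perm (PG3 F)} (hg : g ∈ GStab q a b) :
    ∃ x : Param F q, g = collineation (paramGL q a b x) (RingEquiv.refl F) := by
  obtain ⟨M, rfl⟩ := hg.1
  have hT : c (b + b ^ q) = b + b ^ q := by rw [← hcq, map_add, hc, add_comm]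
  have hT0 : b + b ^ q ≠ 0 := fun h => hb (by
    rw [hcq]; exact (CharTwo.add_eq_zero.1 h).symm)
  rw [mem_GStab_iff (by omega) hcq hc hb] at hg
  set L := rowEquiv M with hL
  have hLQ : ∀ v, quasiForm c a (b + b ^ q) (L v) = 0 ↔ quasiForm c a (b + b ^ q) v = 0 := hg
  have hp := (map_apply_zero hq hF hcq hc ha hT hT0 hb L hLQ).1
  obtain ⟨p, hpd⟩ : ∃ p, p = L ![1, 0, 0, 0] 0 := ⟨_, rfl⟩
  rw [← hpd] at hp
  obtain ⟨γ₁, hγ₁⟩ : ∃ x, x = p⁻¹ * L ![1, 0, 0, 0] 1 := ⟨_, rfl⟩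
  obtain ⟨γ₂, hγ₂⟩ : ∃ x, x = p⁻¹ * L ![1, 0, 0, 0] 2 := ⟨_, rfl⟩
  have hrow := row_psi q a b γ₁ γ₂
  obtain ⟨f, hf⟩ : ∃ f, f = a * (γ₁ ^ 2 + γ₂ ^ 2) + b * (γ₁ ^ (q + 1) + γ₂ ^ (q + 1)) := ⟨_, rfl⟩
  rw [← hf] at hrow
  -- `ψ_γ` maps `(1, 0, 0, 0)` to a point with the same first three coordinates as its image
  -- under `g`; the two last coordinates differ by an element of `GF(q)`
  obtain ⟨s, hs⟩ : ∃ s, s = p⁻¹ * L ![1, 0, 0, 0] 3 - f := ⟨_, rfl⟩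
  have he : p⁻¹ • L ![1, 0, 0, 0] = ![1, 0, 0, 0] ᵥ* psiMat q a b γ₁ γ₂ + ![0, 0, 0, s] := by
    rw [hrow]
    ext i
    fin_cases i
    · simp [← hpd, hp]
    · simp [hγ₁]
    · simp [hγ₂]
    · simp [hs]
  have hQ0 : quasiForm c a (b + b ^ q) ![1, 0, 0, 0] = 0 := by
    simp [quasiForm, hermForm, perturb, tr]
  have hsc : c s = s := by
    have h1 : quasiForm c a (b + b ^ q) (p⁻¹ • L ![1, 0, 0, 0]) = 0 := by
      rw [quasiForm_smul hc, (hLQ _).2 hQ0, mul_zero]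
    rw [he, quasiForm_add_of_onAxis hc hT a _ ⟨rfl, rfl⟩, quasiForm_psi hcq hc, hQ0, zero_add,
      tr_eq_zero_iff] at h1
    rw [hrow] at h1
    simpa [hermForm] using h1
  set N := toGL (psiMat q a b γ₁ γ₂) (det_psiMat _ _ _ _ _) * toGL (phiMat s) (det_phiMat _) with hN
  have hN0 : rowEquiv N ![1, 0, 0, 0] = p⁻¹ • L ![1, 0, 0, 0] := by
    rw [he, rowEquiv_apply, hN, Units.val_mul, ← Matrix.vecMul_vecMul]
    change (![1, 0, 0, 0] ᵥ* psiMat q a b γ₁ γ₂) ᵥ* phiMat s = _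
    rw [hrow]
    ext i
    fin_cases i <;> simp [phiMat, Matrix.vecMul, dotProduct, Fin.sum_univ_four, add_comm]
  have hNQ : ∀ v, quasiForm c a (b + b ^ q) (rowEquiv N v) = quasiForm c a (b + b ^ q) v := by
    intro v
    rw [rowEquiv_apply, hN, Units.val_mul, ← Matrix.vecMul_vecMul]
    change quasiForm c a (b + b ^ q) ((v ᵥ* psiMat q a b γ₁ γ₂) ᵥ* phiMat s) = _
    rw [quasiForm_phi hsc, quasiForm_psi hcq hc]
  -- follow `g` by a translation back to `(1, 0, 0, 0)`
  let g' := (L.trans (LinearEquiv.smulOfNeZero F (Fin 4 → F) p⁻¹ (inv_ne_zero hp))).trans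
    (rowEquiv N).symm
  have hg'v : ∀ v, rowEquiv N (g' v) = p⁻¹ • L v := fun v => by simp [g']
  obtain ⟨δ, e, hδ, hδ0, hec, h⟩ := eq_mu_tau hq hF hcq hc ha hT hT0 hb g' (fun v => by
      rw [← hNQ, hg'v, quasiForm_smul hc, ← hLQ]
      simp [hp]) ((rowEquiv N).injective (by rw [hg'v, hN0]))
  refine ⟨⟨⟨s, by rw [← hcq, hsc]⟩, γ₁, γ₂, ⟨e, by rw [← hcq, hec]⟩, ⟨δ, by rw [← hcq, hδ], hδ0⟩⟩,
    collineation_eq_of_smul (k := p) fun v => ?_⟩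
  have h1 : L v = p • rowEquiv N (g' v) := by rw [hg'v, smul_smul, mul_inv_cancel₀ hp, one_smul]
  rw [semilinearMap_refl, semilinearMap_refl, ← rowEquiv_apply, ← hL, h1, h, rowEquiv_apply,
    Matrix.vecMul_vecMul]
  rfl

theorem GStab_eq_closure [Finite F] (hq : 3 < q) (hF : Nat.card F = q ^ 2)
    (hcq : ∀ x, c x = x ^ q) (hc : ∀ x, c (c x) = x)
    {a b : F} (ha : a ≠ 0) (hb : c b ≠ b) :
    GStab q a b = Subgroup.closure (linearGenerators q a b) := by
  refine le_antisymm (fun g hg => ?_)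
    ((Subgroup.closure_le _).2 (linearGenerators_subset (by omega) hcq hc a hb))
  obtain ⟨x, rfl⟩ := exists_param hq hF hcq hc ha hb hg
  exact paramGL_mem_closure q a b x

theorem paramGL_injective (q : ℕ) (a b : F) :
    Function.Injective fun x : Param F q =>
      collineation (paramGL q a b x) (RingEquiv.refl F) := by
  rintro ⟨⟨s, hs⟩, γ₁, γ₂, ⟨e, he⟩, ⟨δ, hδ, hδ0⟩⟩ ⟨⟨s', hs'⟩, γ₁', γ₂', ⟨e', he'⟩, ⟨δ', hδ', hδ0'⟩⟩ h
  obtain ⟨-, k, hk⟩ := collineation_eq h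
  have hk' : muMat δ * tauMat e * (psiMat q a b γ₁ γ₂ * phiMat s) =
    k • (muMat δ' * tauMat e' * (psiMat q a b γ₁' γ₂' * phiMat s')) := hk
  have hij := fun i j => congrFun (congrFun hk' i) j
  have h00 := hij 0 0
  have h01 := hij 0 1
  have h02 := hij 0 2
  have h03 := hij 0 3
  have h33 := hij 3 3
  have h12 := hij 1 2
  simp [Matrix.mul_apply, Fin.sum_univ_four, muMat, tauMat, psiMat, phiMat]
    at h00 h01 h02 h03 h33 h12
  rw [← h00, one_mul] at h01 h02 h03 h33 h12
  subst h01 h02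
  have hδδ : δ = δ' := sq_injective h33
  subst hδδ
  have hee : e = e' := mul_left_cancel₀ hδ0 h12
  subst hee
  have hss : s = s' := by linear_combination h03
  subst hss
  rfl

end GStab

/-! ### Companion automorphisms -/

/-- The collineation `g` is represented by some matrix and the field automorphism `θ`. -/
def HasCompanion (g : Equiv.Perm (PG3 F)) (θ : F ≃+* F) : Prop := ∃ M, g = collineation M θ

theorem HasCompanion.mul {g h : Equiv.Perm (PG3 F)} {θ η : F ≃+* F} (hg : HasCompanion g θ)
    (hh : HasCompanion h η) : HasCompanion (g * h) (θ * η) := by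
  obtain ⟨M, rfl⟩ := hg
  obtain ⟨N, rfl⟩ := hh
  exact ⟨_, collineation_mul N M η θ⟩

theorem HasCompanion.inv {g : Equiv.Perm (PG3 F)} {θ : F ≃+* F} (hg : HasCompanion g θ) :
    HasCompanion g⁻¹ θ⁻¹ := by
  obtain ⟨M, rfl⟩ := hg
  exact ⟨_, collineation_inv M θ⟩

theorem HasCompanion.pow {g : Equiv.Perm (PG3 F)} {θ : F ≃+* F} (hg : HasCompanion g θ) (n : ℕ) :
    HasCompanion (g ^ n) (θ ^ n) := by
  induction n with
  | zero => exact ⟨1, collineation_one.symm⟩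
  | succ n ih => rw [pow_succ, pow_succ]; exact ih.mul hg

theorem HasCompanion.zpow {g : Equiv.Perm (PG3 F)} {θ : F ≃+* F} (hg : HasCompanion g θ) (n : ℤ) :
    HasCompanion (g ^ n) (θ ^ n) := by
  cases n with
  | ofNat n => exact hg.pow n
  | negSucc n => rw [zpow_negSucc, zpow_negSucc]; exact (hg.pow _).inv

theorem HasCompanion.unique {g : Equiv.Perm (PG3 F)} {θ η : F ≃+* F} (h : HasCompanion g θ)
    (h' : HasCompanion g η) : θ = η := by
  obtain ⟨M, rfl⟩ := h
  obtain ⟨N, h'⟩ := h'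
  exact (collineation_eq h').1

theorem mem_PGammaL4_iff (g : Equiv.Perm (PG3 F)) : g ∈ PGammaL4 F ↔ ∃ θ, HasCompanion g θ :=
  ⟨fun ⟨M, θ, h⟩ => ⟨θ, M, h⟩, fun ⟨θ, M, h⟩ => ⟨M, θ, h⟩⟩

theorem GStab_le_GammaStab (q : ℕ) (a b : F) : GStab q a b ≤ GammaStab q a b :=
  inf_le_inf_right _ fun _ ⟨M, h⟩ => ⟨M, _, h⟩

/-- Collineations of the variety with the same companion differ by a projectivity. -/
theorem mul_inv_mem_GStab {q : ℕ} {a b : F} {g h : Equiv.Perm (PG3 F)} (hg : g ∈ GammaStab q a b)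
    (hh : h ∈ GammaStab q a b) {θ : F ≃+* F} (hgθ : HasCompanion g θ) (hhθ : HasCompanion h θ) :
    g * h⁻¹ ∈ GStab q a b := by
  refine ⟨?_, (mul_mem hg (inv_mem hh)).2⟩
  have := hgθ.mul hhθ.inv
  rwa [mul_inv_cancel] at this

/-- The variety with `a = 1` and `Tr ε = 1` has an equation over the prime field, so it is fixed by
the collineations induced by field automorphisms. -/
theorem image_collineation_one [CharP F 2] {q : ℕ} {c : F →+* F} (hq : 0 < q)
    (hcq : ∀ x, c x = x ^ q) (hc : ∀ x, c (c x) = x) {ε : F} (hε : ε + ε ^ q = 1) (θ : F ≃+* F) :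
    collineation 1 θ '' varietyM q 1 ε = varietyM q 1 ε := by
  have hb : c ε ≠ ε := fun h => by
    rw [← hcq, h, CharTwo.add_self_eq_zero] at hε
    exact zero_ne_one hε
  rw [image_varietyM_iff hq hcq hc hb hb]
  intro v
  have hθ : ∀ x, c (θ x) = θ (c x) := fun x => by rw [hcq, hcq, map_pow]
  have : quasiForm c 1 (ε + ε ^ q) (semilinearMap 1 θ v) = θ (quasiForm c 1 (ε + ε ^ q) v) := by
    rw [semilinearMap_apply, Units.val_one, Matrix.vecMul_one, hε]
    simp only [quasiForm, hermForm, perturb, tr, hθ, map_add, map_mul, map_pow, map_div₀, map_one]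
  rw [this, map_eq_zero_iff _ θ.injective]

theorem conj_mem_GammaStab [CharP F 2] {q : ℕ} {c : F →+* F} (hq : 0 < q)
    (hcq : ∀ x, c x = x ^ q) (hc : ∀ x, c (c x) = x) {a b ε : F} (hε : ε + ε ^ q = 1)
    {β : Equiv.Perm (PG3 F)} {η : F ≃+* F} (hβ : HasCompanion β η)
    (hm : β '' varietyM q 1 ε = varietyM q a b) (θ : F ≃+* F) :
    β * collineation 1 θ * β⁻¹ ∈ GammaStab q a b := by
  refine ⟨(mem_PGammaL4_iff _).2 ⟨_, (hβ.mul ⟨1, rfl⟩).mul hβ.inv⟩, ?_⟩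
  refine (mem_stabilizer_varietyM_iff q a b _).2 ?_
  conv_lhs => rw [← hm]
  rw [Equiv.Perm.coe_mul, Equiv.Perm.coe_mul, Set.image_comp, Set.image_comp, ← Set.image_comp ⇑β⁻¹,
    ← Equiv.Perm.coe_mul, inv_mul_cancel, Equiv.Perm.coe_one, Set.image_id,
    image_collineation_one hq hcq hc hε, hm]

/-- A conjugate `β σ β⁻¹` has the same companion as `σ`, because the automorphism group is cyclic;
so if `σ` is induced by a generator, then `Γ(a,b)` is generated by `G(a,b)` and `β σ β⁻¹`. -/
theorem GammaStab_eq_closure [CharP F 2] {q : ℕ} {c : F →+* F} (hq : 0 < q)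
    (hcq : ∀ x, c x = x ^ q) (hc : ∀ x, c (c x) = x) {a b ε : F} (hε : ε + ε ^ q = 1)
    {β : Equiv.Perm (PG3 F)} {η : F ≃+* F} (hβ : HasCompanion β η)
    (hm : β '' varietyM q 1 ε = varietyM q a b) {θ : F ≃+* F}
    (hθ : ∀ η : F ≃+* F, η ∈ Subgroup.zpowers θ) {S : Set (Equiv.Perm (PG3 F))}
    (hS : Subgroup.closure S = GStab q a b) :
    GammaStab q a b = Subgroup.closure (S ∪ {β * collineation 1 θ * β⁻¹}) := by
  have hmem := conj_mem_GammaStab hq hcq hc hε hβ hm θ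
  have hcomp : HasCompanion (β * collineation 1 θ * β⁻¹) θ := by
    have h1 := (hβ.mul (⟨1, rfl⟩ : HasCompanion (collineation 1 θ) θ)).mul hβ.inv
    obtain ⟨n, rfl⟩ := hθ η
    have h2 : θ ^ n * θ * (θ ^ n)⁻¹ = θ := by
      rw [mul_inv_eq_iff_eq_mul]
      exact (Commute.refl θ).zpow_left n
    rwa [h2] at h1
  apply le_antisymm
  · intro g hg
    obtain ⟨ζ, hζ⟩ := (mem_PGammaL4_iff g).1 hg.1
    obtain ⟨n, rfl⟩ := hθ ζ
    have h1 := mul_inv_mem_GStab hg (zpow_mem hmem n) hζ (hcomp.zpow n)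
    rw [← hS] at h1
    have h2 := Subgroup.closure_mono (Set.subset_union_left (t := {β * collineation 1 θ * β⁻¹})) h1
    have h3 : β * collineation 1 θ * β⁻¹ ∈
        Subgroup.closure (S ∪ {β * collineation 1 θ * β⁻¹}) :=
      Subgroup.subset_closure (Or.inr rfl)
    have h4 := mul_mem h2 (zpow_mem h3 n)
    rwa [inv_mul_cancel_right] at h4
  · rw [Subgroup.closure_le]
    rintro g (hg | rfl)
    · exact GStab_le_GammaStab q a b (hS ▸ Subgroup.subset_closure hg)
    · exact hmem

end Stabilizer

section NormalForms

variable {F : Type*} [Field F]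

/-! ### Normal forms -/

/-- The conditions under which a matrix of the normal form carries `M_{1,ε}` to `M_{a,b}`. -/
theorem quasiForm_normalForm {c : F →+* F} {a T C d e l₁ l₂ : F} (hC : c C = C)
    (h1 : a * (d + e) ^ 2 = C) (h2 : l₁ * e + l₂ * d = d + e) (h3 : T * (d * c d + e * c e) = C)
    (h4 : c d * (l₁ * e) + c e * (l₂ * d) = 0) (hl₁ : l₁ * c l₁ = 1) (hl₂ : l₂ * c l₂ = 1)
    (hc : ∀ x, c (c x) = x) (v : Fin 4 → F) :
    quasiForm c a T (v ᵥ* !![1, 0, 0, 0; 0, d, e, 0; 0, l₁ * e, l₂ * d, 0; 0, 0, 0, C]) =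
      C * quasiForm c 1 1 v := by
  have e1 : v ᵥ* !![1, 0, 0, 0; 0, d, e, 0; 0, l₁ * e, l₂ * d, 0; 0, 0, 0, C] =
      ![v 0, d * v 1 + l₁ * e * v 2, e * v 1 + l₂ * d * v 2, C * v 3] := by
    ext i
    fin_cases i <;> simp [Matrix.vecMul, dotProduct, Fin.sum_univ_four, mul_comm]
  have e2 : d * v 1 + l₁ * e * v 2 + (e * v 1 + l₂ * d * v 2) = (d + e) * (v 1 + v 2) := by
    linear_combination v 2 * h2
  have hp : perturb c a (v 0) ((d + e) * (v 1 + v 2)) = C * perturb c 1 (v 0) (v 1 + v 2) := by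
    rw [perturb, perturb, ← tr_mul_of_fixed hC, ← h1]; congr 1; ring
  have h4' := congrArg c h4
  simp only [map_add, map_mul, map_zero, hc] at h4'
  rw [e1, quasiForm, quasiForm]
  simp only [hermForm]
  simp [e2, hp, hC]
  linear_combination (c (v 1) * v 1 + c (v 2) * v 2) * h3 +
    T * c (v 2) * v 2 * (c e * e * hl₁ + c d * d * hl₂) + T * c (v 1) * v 2 * h4 +
    T * v 1 * c (v 2) * h4'

variable [CharP F 2] {q : ℕ} {c : F →+* F}

/-- Hilbert's Theorem 90 for an involution. -/
theorem exists_conj_eq_mul {c : F →+* F} (hc : ∀ x, c (c x) = x) {u : F} (hu : u * c u = 1) :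
    ∃ e, e ≠ 0 ∧ c e = u * e := by
  by_cases h1 : 1 + c u = 0
  · have hcu : c u = 1 := (CharTwo.add_eq_zero.1 h1).symm
    exact ⟨1, one_ne_zero, by rw [← hc u, hcu, map_one, mul_one]⟩
  · exact ⟨1 + c u, h1, by rw [map_add, map_one, hc]; linear_combination -hu⟩

theorem exists_normalForm [Finite F] (hq : 0 < q)
    (hcq : ∀ x, c x = x ^ q) (hc : ∀ x, c (c x) = x)
    {a b ε : F} (ha : a ≠ 0) (hb : c b ≠ b) (hε : ε + ε ^ q = 1) :
    ∃ M : GL (Fin 4) F, HasNormalForm q (collineation M (RingEquiv.refl F)) ∧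
      collineation M (RingEquiv.refl F) '' varietyM q 1 ε = varietyM q a b := by
  have htwo := CharTwo.two_eq_zero (R := F)
  have hbε : c ε ≠ ε := fun h => by
    rw [← hcq, h, CharTwo.add_self_eq_zero] at hε
    exact zero_ne_one hε
  obtain ⟨T, hTd⟩ : ∃ T, T = b + b ^ q := ⟨_, rfl⟩
  have hT : c T = T := by rw [hTd, ← hcq, map_add, hc, add_comm]
  have hT0 : T ≠ 0 := fun h => hb (by
    rw [hcq]; exact (CharTwo.add_eq_zero.1 (hTd ▸ h)).symm)
  have hca : c a ≠ 0 := (map_ne_zero c).2 ha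
  have hnorm : ∀ x, x * c x = 1 → x ^ (q + 1) = 1 := fun x hx => by
    rw [pow_succ, ← hcq, mul_comm, hx]
  -- reduction to the conditions of `quasiForm_normalForm`
  suffices ∃ C d e l₁ l₂ : F, c C = C ∧ C ≠ 0 ∧ a * (d + e) ^ 2 = C ∧
      l₁ * e + l₂ * d = d + e ∧ T * (d * c d + e * c e) = C ∧
      c d * (l₁ * e) + c e * (l₂ * d) = 0 ∧ l₁ * c l₁ = 1 ∧ l₂ * c l₂ = 1 ∧
      l₂ * d ^ 2 + l₁ * e ^ 2 ≠ 0 ∧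
      ((e = 0 ∧ d ≠ 0 ∧ l₂ = 1) ∨
      (e ≠ 0 ∧ d = 0 ∧ l₁ = 1) ∨
      (e ≠ 0 ∧ d ≠ 0 ∧ l₁ = 1 ∧ l₂ = 1 ∧ (d / e) ^ q = d / e ∧ d / e ≠ 1) ∨
      (e ≠ 0 ∧ d ≠ 0 ∧ l₂ ≠ 1 ∧ l₁ ≠ 1 ∧ l₁ ≠ l₂ ∧ d = (1 + l₁) / (1 + l₂) * e)) by
    obtain ⟨C, d, e, l₁, l₂, hC, hC0, h1, h2, h3, h4, hl₁, hl₂, hdet, h5⟩ := this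
    have hdet' : (!![1, 0, 0, 0; 0, d, e, 0; 0, l₁ * e, l₂ * d, 0; 0, 0, 0, C]).det ≠ 0 := by
      have : (!![1, 0, 0, 0; 0, d, e, 0; 0, l₁ * e, l₂ * d, 0; 0, 0, 0, C]).det =
          C * (l₂ * d ^ 2 + l₁ * e ^ 2) := by
        simp [Matrix.det_succ_row_zero, Fin.sum_univ_succ]
        linear_combination -C * l₁ * e ^ 2 * htwo
      rw [this]
      exact mul_ne_zero hC0 hdet
    refine ⟨toGL _ hdet', ⟨_, _, C, d, e, l₁, l₂, rfl, rfl, by rw [← hcq, hC], hC0,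
      hnorm _ hl₁, hnorm _ hl₂, h5⟩, ?_⟩
    rw [image_varietyM_iff hq hcq hc hbε hb]
    intro v
    rw [semilinearMap_refl, hε, ← hTd]
    change quasiForm c a T
      (v ᵥ* !![1, 0, 0, 0; 0, d, e, 0; 0, l₁ * e, l₂ * d, 0; 0, 0, 0, C]) = 0 ↔ _
    rw [quasiForm_normalForm hC h1 h2 h3 h4 hl₁ hl₂ hc]
    simp [hC0]
  -- `κ² = T² / N(a)`; a matrix of type (I) needs `a d² = T N(d)`, hence `κ = 1`
  obtain ⟨w, hw⟩ := exists_sq_eq (a * c a)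
  have hw0 : w ≠ 0 := fun h => mul_ne_zero ha hca (by rw [← hw, h]; ring)
  have hwc : c w = w := sq_injective (by rw [← map_pow, hw, map_mul, hc, mul_comm])
  obtain ⟨κ, hκ⟩ : ∃ κ, κ = T / w := ⟨_, rfl⟩
  have hκw : κ * w = T := by rw [hκ, div_mul_cancel₀ _ hw0]
  have hκ0 : κ ≠ 0 := by rw [hκ]; exact div_ne_zero hT0 hw0
  have hκc : c κ = κ := by rw [hκ, map_div₀, hT, hwc]
  by_cases hκ1 : κ = 1
  · obtain ⟨d, hd0, hd⟩ := exists_conj_eq_mul hc (u := a / T) (by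
      rw [map_div₀, hT]; field_simp; rw [← hw, ← hκw, hκ1]; ring)
    have hd' : T * c d = a * d := by rw [hd]; field_simp
    refine ⟨a * d ^ 2, d, 0, 1, 1, ?_, by positivity, by ring, by ring, ?_, by simp, by simp,
      by simp, by simpa using hd0, Or.inl ⟨rfl, hd0, rfl⟩⟩
    · have : a * d ^ 2 = T * (d * c d) := by linear_combination -d * hd'
      rw [this, map_mul, map_mul, hc, hT, mul_comm d]
    · rw [map_zero]; linear_combination d * hd'
  · have hb0 : b ≠ 0 := fun h => hb (by rw [h, map_zero])
    have hcb0 : c b ≠ 0 := (map_ne_zero c).2 hb0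
    -- type (IV): `l₂ ≠ 1` of norm `1` is arbitrary, and `l₁` is determined by
    -- `l₁ + l₂ = κ (1 + l₁ l₂)`, the condition under which `e` exists
    obtain ⟨l₂, hl₂d⟩ : ∃ l, l = c b / b := ⟨_, rfl⟩
    have hl₂ : l₂ * c l₂ = 1 := by rw [hl₂d, map_div₀, hc]; field_simp
    have hl₂1 : l₂ ≠ 1 := fun h => hb (by rw [hl₂d, div_eq_one_iff_eq hb0] at h; exact h)
    have hl₂0 : l₂ ≠ 0 := left_ne_zero_of_mul_eq_one hl₂
    have hl₂s : l₂ ^ 2 ≠ 1 := fun h => hl₂1 (sq_injective (by rw [h, one_pow]))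
    have hne : ∀ x y : F, x ≠ y → x + y ≠ 0 := fun x y h h' => h (CharTwo.add_eq_zero.1 h')
    have h1l₂ : 1 + l₂ ≠ 0 := hne _ _ hl₂1.symm
    have hκl : κ + l₂ ≠ 0 := fun h => by
      have h1 : l₂ = κ := (CharTwo.add_eq_zero.1 h).symm
      rw [h1, hκc] at hl₂
      exact hl₂s (by rw [h1, sq, hl₂])
    have hD : 1 + κ * l₂ ≠ 0 := fun h => by
      apply (map_ne_zero c).2 hκl
      rw [map_add, hκc]
      refine mul_left_cancel₀ hl₂0 ?_
      linear_combination h + hl₂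
    obtain ⟨l₁, hl₁d⟩ : ∃ l, l = (κ + l₂) / (1 + κ * l₂) := ⟨_, rfl⟩
    have hl₁e : l₁ * (1 + κ * l₂) = κ + l₂ := by rw [hl₁d, div_mul_cancel₀ _ hD]
    have hl₁0 : l₁ ≠ 0 := by rw [hl₁d]; exact div_ne_zero hκl hD
    have hP : l₁ + l₂ = κ * (1 + l₁ * l₂) := by
      linear_combination hl₁e + (l₂ - κ * l₁ * l₂) * htwo
    have hl₁ : l₁ * c l₁ = 1 := by
      have h1 : c l₁ * (l₂ + κ) = κ * l₂ + 1 := by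
        have := congrArg c hl₁e
        rw [map_mul, map_add, map_mul, map_add, map_one, hκc] at this
        linear_combination l₂ * this + (1 - κ * c l₁) * hl₂
      refine mul_left_cancel₀ hD (mul_left_cancel₀ hκl ?_)
      linear_combination (κ + l₂) * c l₁ * hl₁e + (κ + l₂) * h1
    have hl₁1 : l₁ ≠ 1 := fun h => by
      rw [h] at hl₁e
      refine mul_ne_zero (hne _ _ hκ1) h1l₂ ?_
      linear_combination hl₁e + (κ + l₂) * htwo
    have hl₁₂ : l₁ ≠ l₂ := fun h => by
      rw [h] at hl₁e
      refine hl₂s (mul_left_cancel₀ hκ0 ?_)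
      linear_combination hl₁e
    have hR : 1 + l₁ * l₂ ≠ 0 := fun h => by
      rw [h, mul_zero] at hP
      exact hne _ _ hl₁₂ hP
    have hcl₁ : c l₁ = l₁⁻¹ := eq_inv_of_mul_eq_one_right hl₁
    obtain ⟨e, he0, he⟩ := exists_conj_eq_mul hc (u := κ * a * l₁ / T) (by
      simp only [map_div₀, map_mul, hT, hκc, hcl₁]
      field_simp
      rw [← hκw, mul_pow, hw, mul_assoc])
    have hce : T * c e = κ * a * l₁ * e := by rw [he]; field_simp
    obtain ⟨d, hdd⟩ : ∃ d, d = (1 + l₁) / (1 + l₂) * e := ⟨_, rfl⟩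
    have hd : (1 + l₂) * d = (1 + l₁) * e := by rw [hdd]; field_simp
    have hcd : l₁ * (1 + l₂) * c d = l₂ * (1 + l₁) * c e := by
      have := congrArg c hd
      rw [map_mul, map_mul, map_add, map_add, map_one] at this
      linear_combination l₁ * l₂ * this + (c e * l₂) * hl₁ - l₁ * c d * hl₂
    have hd0 : d ≠ 0 := by
      rw [hdd]; exact mul_ne_zero (div_ne_zero (hne _ _ hl₁1.symm) h1l₂) he0
    have hde : (1 + l₂) * (d + e) = (l₁ + l₂) * e := by linear_combination hd + e * htwo
    have h3 : T * (d * c d + e * c e) = a * (d + e) ^ 2 := by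
      refine mul_left_cancel₀ (mul_ne_zero hl₁0 (pow_ne_zero 2 h1l₂)) ?_
      linear_combination T * (l₁ * (1 + l₂) * c d) * hd + T * (1 + l₁) * e * hcd +
        e * ((1 + l₁) ^ 2 * l₂ + l₁ * (1 + l₂) ^ 2) * hce - a * l₁ * e ^ 2 * (l₁ + l₂) * hP -
        l₁ * a * ((1 + l₂) * (d + e) + (l₁ + l₂) * e) * hde +
        2 * κ * a * l₁ ^ 2 * l₂ * e ^ 2 * htwo
    refine ⟨a * (d + e) ^ 2, d, e, l₁, l₂, ?_, ?_, rfl, ?_, h3, ?_, hl₁, hl₂, ?_,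
      Or.inr (Or.inr (Or.inr ⟨he0, hd0, hl₂1, hl₁1, hl₁₂, hdd⟩))⟩
    · rw [← h3, map_mul, map_add, map_mul, map_mul, hc, hc, hT]; ring
    · refine mul_ne_zero ha (pow_ne_zero 2 fun h => ?_)
      rw [h, mul_zero, eq_comm] at hde
      exact mul_ne_zero (hne _ _ hl₁₂) he0 hde
    · linear_combination hd + (l₁ * e - d) * htwo
    · refine mul_left_cancel₀ h1l₂ ?_
      linear_combination e * hcd + c e * l₂ * hd + l₂ * (1 + l₁) * e * c e * htwo
    · intro h
      refine mul_ne_zero (mul_ne_zero (hne _ _ hl₁₂) hR) (pow_ne_zero 2 he0) ?_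
      linear_combination (1 + l₂) ^ 2 * h - l₂ * ((1 + l₂) * d + (1 + l₁) * e) * hd -
        2 * l₁ * l₂ * e ^ 2 * htwo

end NormalForms

section Counting

variable {F : Type*} [Field F]

/-! ### Counting -/

/-- `F = GF(q) ⊕ GF(q) b` for every `b` outside `GF(q)`. -/
theorem card_fixed [CharP F 2] [Finite F] {q : ℕ} (hF : Nat.card F = q ^ 2) {c : F →+* F}
    (hcq : ∀ x, c x = x ^ q) (hc : ∀ x, c (c x) = x) {b : F} (hb : c b ≠ b) :
    Nat.card {s : F // s ^ q = s} = q := by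
  have htr : tr c b ≠ 0 := fun h => hb ((tr_eq_zero_iff c b).1 h)
  have hbij : Function.Bijective fun x : {s : F // s ^ q = s} × {s : F // s ^ q = s} =>
      (x.1 : F) + x.2 * b := by
    constructor
    · rintro ⟨⟨s, hs⟩, t, ht⟩ ⟨⟨s', hs'⟩, t', ht'⟩ h
      simp only [← hcq] at hs ht hs' ht' h
      have h1 := congrArg (tr c) h
      rw [tr_add, tr_add, tr_mul_of_fixed ht, tr_mul_of_fixed ht', (tr_eq_zero_iff c s).2 hs,
        (tr_eq_zero_iff c s').2 hs', zero_add, zero_add] at h1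
      have h2 := mul_right_cancel₀ htr h1
      subst h2
      have h3 := add_right_cancel h
      subst h3
      rfl
    · intro x
      obtain ⟨t, htd⟩ : ∃ t, t = tr c x / tr c b := ⟨_, rfl⟩
      have ht : c t = t := by rw [htd, map_div₀, conj_tr hc, conj_tr hc]
      refine ⟨⟨⟨x - t * b, ?_⟩, t, by rw [← hcq, ht]⟩, by simp⟩
      rw [← hcq, ← tr_eq_zero_iff, CharTwo.sub_eq_add, tr_add, tr_mul_of_fixed ht, htd,
        div_mul_cancel₀ _ htr, CharTwo.add_self_eq_zero]
  have h1 := Nat.card_congr (Equiv.ofBijective _ hbij)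
  rw [Nat.card_prod, hF, sq] at h1
  exact Nat.mul_self_inj.1 h1

theorem card_fixed_ne_zero [Finite F] {q : ℕ} (hq : 0 < q)
    (h : Nat.card {s : F // s ^ q = s} = q) :
    Nat.card {s : F // s ^ q = s ∧ s ≠ 0} = q - 1 := by
  have h1 : {s : F | s ^ q = s ∧ s ≠ 0} = {s : F | s ^ q = s} \ {0} := by ext; simp
  have h2 : Nat.card {s : F // s ^ q = s ∧ s ≠ 0} = ({s : F | s ^ q = s} \ {0}).ncard := by
    rw [← h1]; rfl
  have h3 : ({s : F | s ^ q = s}).ncard = q := h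
  rw [h2, Set.ncard_sdiff_singleton_of_mem (by simp [hq.ne']), h3]

theorem card_ringAut [CharP F 2] [Finite F] {n : ℕ} (hF : Nat.card F = 2 ^ n) :
    Nat.card (F ≃+* F) = n := by
  let _ := ZMod.algebra F 2
  let e : (F ≃+* F) ≃ (F ≃ₐ[ZMod 2] F) :=
    { toFun := fun θ => AlgEquiv.ofRingEquiv (f := θ) fun x =>
        RingHom.congr_fun (RingHom.ext_zmod ((θ : F →+* F).comp (algebraMap (ZMod 2) F))
          (algebraMap (ZMod 2) F)) x
      invFun := fun θ => θ.toRingEquiv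
      left_inv := fun _ => rfl
      right_inv := fun _ => rfl }
  have hfin : Module.Finite (ZMod 2) F := Module.Finite.of_finite
  have h1 := Module.natCard_eq_pow_finrank (K := ZMod 2) (V := F)
  rw [hF, Nat.card_zmod] at h1
  rw [Nat.card_congr e, ← Nat.pow_right_injective le_rfl h1.symm]
  exact IsGalois.card_aut_eq_finrank (ZMod 2) F

/-- Every collineation of the variety is uniquely `g (β σ_θ β⁻¹)`, with `g` in the linear
stabilizer and `θ` a field automorphism. -/
theorem card_GammaStab [CharP F 2] [Finite F] {q : ℕ} {c : F →+* F} (hq : 3 < q)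
    (hF : Nat.card F = q ^ 2) (hcq : ∀ x, c x = x ^ q) (hc : ∀ x, c (c x) = x)
    {a b : F} (ha : a ≠ 0) (hb : c b ≠ b) :
    Nat.card (GammaStab q a b) = q ^ 6 * (q - 1) * Nat.card (F ≃+* F) := by
  obtain ⟨ε, hε⟩ := tr_surjective_on_fixed hc hb (map_one c)
  rw [tr, hcq] at hε
  obtain ⟨B, -, hB⟩ := exists_normalForm (by omega) hcq hc ha hb hε
  set β := collineation B (RingEquiv.refl F)
  have hβ : HasCompanion β 1 := ⟨B, rfl⟩
  have hσ : ∀ θ, HasCompanion (β * collineation 1 θ * β⁻¹) θ := fun θ => by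
    simpa using (hβ.mul (⟨1, rfl⟩ : HasCompanion (collineation 1 θ) θ)).mul hβ.inv
  have hσm := conj_mem_GammaStab (by omega) hcq hc hε hβ hB
  have hlin : ∀ x : Param F q, collineation (paramGL q a b x) (RingEquiv.refl F) ∈ GStab q a b :=
    fun x => by
      rw [GStab_eq_closure hq hF hcq hc ha hb]
      exact paramGL_mem_closure q a b x
  let f : Param F q × (F ≃+* F) → GammaStab q a b := fun x =>
    ⟨collineation (paramGL q a b x.1) (RingEquiv.refl F) * (β * collineation 1 x.2 * β⁻¹),
      mul_mem (GStab_le_GammaStab q a b (hlin x.1)) (hσm x.2)⟩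
  have hf : Function.Bijective f := by
    constructor
    · rintro ⟨x, θ⟩ ⟨x', θ'⟩ h
      have h1 : collineation (paramGL q a b x) (RingEquiv.refl F) *
          (β * collineation 1 θ * β⁻¹) = collineation (paramGL q a b x') (RingEquiv.refl F) *
          (β * collineation 1 θ' * β⁻¹) := congrArg Subtype.val h
      have hθ : θ = θ' := by
        have c1 := HasCompanion.mul (⟨_, rfl⟩ : HasCompanion
          (collineation (paramGL q a b x) (RingEquiv.refl F)) 1) (hσ θ)
        have c2 := HasCompanion.mul (⟨_, rfl⟩ : HasCompanion
          (collineation (paramGL q a b x') (RingEquiv.refl F)) 1) (hσ θ')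
        rw [h1] at c1
        simpa using c1.unique c2
      subst hθ
      rw [paramGL_injective q a b (mul_right_cancel h1)]
    · rintro ⟨g, hg⟩
      obtain ⟨θ, hθ⟩ := (mem_PGammaL4_iff g).1 hg.1
      obtain ⟨x, hx⟩ := exists_param hq hF hcq hc ha hb (mul_inv_mem_GStab hg (hσm θ) hθ (hσ θ))
      refine ⟨(x, θ), Subtype.ext ?_⟩
      change collineation (paramGL q a b x) (RingEquiv.refl F) * (β * collineation 1 θ * β⁻¹) = g
      rw [← hx, inv_mul_cancel_right]
  have hK := card_fixed hF hcq hc hb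
  rw [← Nat.card_congr (Equiv.ofBijective f hf)]
  simp only [Nat.card_prod]
  rw [hK, card_fixed_ne_zero (by omega) hK, hF]
  ring

end Counting

end QuasiHermitian

theorem theorem5p5 {F : Type*} [Field F] [Finite F] (q : ℕ) (hq : ∃ h : ℕ, q = 2 ^ h)
    (hq2 : 2 < q) (hF : Nat.card F = q ^ 2) (a b : F) (ha : a ≠ 0) (hb : b ^ q ≠ b) :
    Nat.card (GammaStab q a b) = q ^ 6 * (q - 1) * (2 * Nat.log 2 q) ∧
    ∀ ε : F, ε + ε ^ q = 1 →
      (∃ β : Equiv.Perm (PG3 F), HasNormalForm q β ∧ β '' varietyM q 1 ε = varietyM q a b) ∧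
      ∀ β : Equiv.Perm (PG3 F), HasNormalForm q β → β '' varietyM q 1 ε = varietyM q a b →
        ∀ θ : F ≃+* F, (∀ η : F ≃+* F, η ∈ Subgroup.zpowers θ) →
          GammaStab q a b =
            Subgroup.closure (linearGenerators q a b ∪ {β * collineation 1 θ * β⁻¹}) ∧
          GammaStab q a b =
            Subgroup.closure
              ((GStab q a b : Set (Equiv.Perm (PG3 F))) ∪ {β * collineation 1 θ * β⁻¹}) := by
  obtain ⟨h, rfl⟩ := hq
  have hh : 1 < h := (Nat.pow_lt_pow_iff_right (a := 2) one_lt_two).1 (by simpa using hq2)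
  have hq3 : 3 < 2 ^ h := lt_of_lt_of_le (by norm_num) (Nat.pow_le_pow_right two_pos hh)
  have hF' : Nat.card F = 2 ^ (2 * h) := by rw [hF, ← pow_mul, mul_comm]
  have hchar : CharP F 2 := by
    have := Fintype.ofFinite F
    exact charP_of_card_eq_prime_pow (f := 2 * h) (by rw [← Nat.card_eq_fintype_card, hF'])
  have hcq : ∀ x, iterateFrobenius F 2 h x = x ^ 2 ^ h := iterateFrobenius_def 2 h
  have hc : ∀ x, iterateFrobenius F 2 h (iterateFrobenius F 2 h x) = x := fun x => by
    have := Fintype.ofFinite F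
    rw [hcq, hcq, ← pow_mul, ← sq, ← hF, Nat.card_eq_fintype_card, FiniteField.pow_card]
  have hb' : iterateFrobenius F 2 h b ≠ b := by rwa [hcq]
  have hG := QuasiHermitian.GStab_eq_closure hq3 hF hcq hc ha hb'
  refine ⟨?_, fun ε hε => ⟨?_, ?_⟩⟩
  · rw [QuasiHermitian.card_GammaStab hq3 hF hcq hc ha hb', QuasiHermitian.card_ringAut hF',
      Nat.log_pow one_lt_two]
  · obtain ⟨M, hM, hM'⟩ := QuasiHermitian.exists_normalForm (by omega) hcq hc ha hb' hε
    exact ⟨_, hM, hM'⟩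
  · rintro β ⟨A, η, -, -, -, -, -, hβ, -⟩ hm θ hθ
    exact ⟨QuasiHermitian.GammaStab_eq_closure (by omega) hcq hc hε ⟨A, hβ⟩ hm hθ hG.symm,
      QuasiHermitian.GammaStab_eq_closure (by omega) hcq hc hε ⟨A, hβ⟩ hm hθ
        (Subgroup.closure_eq _)⟩
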